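/- **Setting.** Let $V=\bigoplus_{n\in\mathbb Z}V_n$ be a vertex operator algebra over $\mathbb C$ with vacuum $\mathbf 1$, Virasoro element $\omega$ and central charge $c$, and let $U$ be an irreducible $V$-module ($\mathbb Z_{\ge 0}$-graded with finite-dimensional homogeneous subspaces, each a scalar eigenspace for $L(0)$). Write $a(n)$, $n\in\mathbb Z$, for the modes of $a\in V$ on $U$. For $a\in V_p$ and $n\in\mathbb Z$ put $$a[n]=\operatorname{Res}_z\, Y(a,z)\,(\log(1+z))^n(1+z)^{p-1},$$ extended linearly in $a$; equivalently $\sum_n a[n]z^{-n-1}=Y(a,e^z-1)e^{pz}$ for $a\in V_p$. Put $\tilde\omega=\omega-\frac{c}{24}\mathbf 1$, $L[n]=\tilde\omega[n+1]$ and $U_{[k]}=\{u\in U: L[0]u=ku\}$ for $k\in\mathbb C$. Let $\mathcal H$ be the upper half-plane and $M(\Gamma(1))$ the ring of holomorphic modular forms (of all weights) for $SL_2(\mathbb Z)$. Let $E_k(\tau)=(2\pi i)^{-k}\sum_{(m,n)\ne(0,0)}(m\tau+n)^{-k}$ for even $k\ge 2$, where for $k=2$ one sums over $n$ first and then over $m$.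 Let $O_q(U)$ be the $M(\Gamma(1))$-submodule of $U(\Gamma(1))=M(\Gamma(1))\otimes_{\mathbb C}U$ generated by all $$v[0]u\qquad\text{and}\qquad v[-2]u+\sum_{j\ge 2}(2j-1)E_{2j}\otimes v[2j-2]u\qquad(v\in V,\ u\in U).$$ Let $C_1(U)$ be the complex vector space of functions $S:U(\Gamma(1))\times\mathcal H\to\mathbb C$ such that 1. $S(x,\tau)$ is holomorphic in $\tau$ for every $x\in U(\Gamma(1))$; 2. $S$ is $M(\Gamma(1))$-linear: it is $\mathbb C$-linear in $x$ and $S(fx,\tau)=f(\tau)S(x,\tau)$ for $f\in M(\Gamma(1))$; 3. $S(x,\tau)=0$ for $x\in O_q(U)$; 4. for every $k\in\mathbb C$ and $u\in U_{[k]}$, $$S(L[-2]u,\tau)=\frac1{2\pi i}\frac{d}{d\tau}S(u,\tau)+kE_2(\tau)S(u,\tau)+\sum_{j\ge 2}E_{2j}(\tau)S(L[2j-2]u,\tau).$$ **Theorem 5.1.** Assume that the weights of $U$ are real, and let $t\in(-1,1]$ and $m\in\mathbb Z$ be such that $t+2m$ is the lowest weight of $U$. Let $\gamma=\begin{pmatrix}0&-1\\1&0\end{pmatrix}$.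 For $S\in C_1(U)$ there is exactly one $M(\Gamma(1))$-linear function $S|\gamma: U(\Gamma(1))\times\mathcal H\to\mathbb C$ with $$S|\gamma(u,\tau)=(-i\tau)^{-t}\,\tau^{t-k}\,S(u,-1/\tau)\qquad\text{for all } k \text{ and } u\in U_{[k]},$$ where $(-i\tau)^{-t}$ is the principal branch (and $\tau^{t-k}$ is an integral power of $\tau$ whenever $U_{[k]}\neq0$). Moreover $S|\gamma\in C_1(U)$. -/

import Mathlib

open scoped TensorProduct Manifold MatrixGroups UpperHalfPlane

noncomputable section

namespace TraceVOA

/-! ## Vertex operator algebras and their modules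

A vertex operator `Y(a, z) = ∑ a(n) z ^ (-n-1)` is recorded by its modes: `Y a n` is the
endomorphism `a(n)`. All infinite sums below have only finitely many nonzero terms. -/

section General

variable {V U : Type*} [AddCommGroup V] [Module ℂ V] [AddCommGroup U] [Module ℂ U]

/-- Lower truncation: `a(n) u = 0` for all sufficiently large `n`. -/
def Truncated (YU : V →ₗ[ℂ] ℤ → Module.End ℂ U) : Prop :=
  ∀ (a : V) (u : U), ∃ N : ℤ, ∀ n, N ≤ n → YU a n u = 0

/-- The Jacobi identity for vertex operators, in component form:
`∑ᵢ C(m,i) (a(l+i)b)(m+n-i)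
  = ∑ᵢ (-1)^i C(l,i) (a(m+l-i) b(n+i) - (-1)^l b(n+l-i) a(m+i))`.
Taking `l` large gives commutativity, and `m = 0` gives associativity. -/
def JacobiIdentity (Y : V →ₗ[ℂ] ℤ → Module.End ℂ V) (YU : V →ₗ[ℂ] ℤ → Module.End ℂ U) : Prop :=
  ∀ (a b : V) (u : U) (l m n : ℤ),
    ∑ᶠ i : ℕ, ((Ring.choose m i : ℤ) : ℂ) • YU (Y a (l + i) b) (m + n - i) u =
    ∑ᶠ i : ℕ, ((-1 : ℂ) ^ i * ((Ring.choose l i : ℤ) : ℂ)) •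
      (YU a (m + l - i) (YU b (n + i) u) - (-1 : ℂ) ^ l • YU b (n + l - i) (YU a (m + i) u))

/-- The Virasoro relations with central charge `c`. -/
def VirasoroRelations (L : ℤ → Module.End ℂ U) (c : ℂ) : Prop :=
  ∀ m n : ℤ, L m * L n - L n * L m =
    ((m : ℂ) - n) • L (m + n) +
      (if m + n = 0 then (((m : ℂ) ^ 3 - m) / 12 * c) • (1 : Module.End ℂ U) else 0)

end General

/-- A vertex operator algebra structure on the complex vector space `V`. The weight spaces are
`V_n = {v | L(0) v = n v}`, where `L(n) = ω(n+1)`. -/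
structure VertexOperatorAlgebra (V : Type*) [AddCommGroup V] [Module ℂ V] where
  /-- `Y a n` is the mode `a(n)`. -/
  Y : V →ₗ[ℂ] ℤ → Module.End ℂ V
  /-- the vacuum element -/
  vac : V
  /-- the Virasoro element -/
  ω : V
  /-- the central charge -/
  c : ℂ
  truncated : Truncated Y
  vac_mode : ∀ n : ℤ, Y vac n = if n = -1 then 1 else 0
  mode_vac : ∀ (a : V) (n : ℤ), 0 ≤ n → Y a n vac = 0
  creation : ∀ a : V, Y a (-1) vac = a
  jacobi : JacobiIdentity Y Y
  virasoro : VirasoroRelations (fun n ↦ Y ω (n + 1)) c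
  derivative : ∀ (a : V) (n : ℤ), Y (Y ω 0 a) n = (-(n : ℂ)) • Y a (n - 1)
  vac_weight : Y ω 1 vac = 0
  ω_weight : Y ω 1 ω = (2 : ℂ) • ω
  internal : DirectSum.IsInternal fun n : ℤ ↦ Module.End.eigenspace (Y ω 1) (n : ℂ)
  finiteDimensional : ∀ n : ℤ, FiniteDimensional ℂ (Module.End.eigenspace (Y ω 1) (n : ℂ))
  bounded_below : ∃ N : ℤ, ∀ n < N, Module.End.eigenspace (Y ω 1) (n : ℂ) = ⊥

namespace VertexOperatorAlgebra

variable {V : Type*} [AddCommGroup V] [Module ℂ V] (A : VertexOperatorAlgebra V)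

/-- The weight space `V_n`. -/
abbrev weightSpace (n : ℤ) : Submodule ℂ V := Module.End.eigenspace (A.Y A.ω 1) (n : ℂ)

/-- The component of `a` of weight `p` in `V = ⨁ V_p`. -/
def component (p : ℤ) (a : V) : V :=
  ((LinearEquiv.ofBijective (DirectSum.coeLinearMap A.weightSpace) A.internal).symm a) p

/-- The Virasoro element `ω̃ = ω - c/24` of the second vertex operator algebra structure. -/
def ωTilde : V := A.ω - (A.c / 24) • A.vac

/-- A module for a vertex operator algebra, with its grading `U = ⨁_{n ≥ 0} U(n)` by finite
dimensional spaces on which `L(0)` is scalar; for `a ∈ V_p` the mode `a(m)` has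
degree `p - m - 1`. -/
structure VModule (U : Type*) [AddCommGroup U] [Module ℂ U] where
  /-- `YU a n` is the mode `a(n)` acting on the module. -/
  YU : V →ₗ[ℂ] ℤ → Module.End ℂ U
  truncated : Truncated YU
  vac_mode : ∀ n : ℤ, YU A.vac n = if n = -1 then 1 else 0
  jacobi : JacobiIdentity A.Y YU
  virasoro : VirasoroRelations (fun n ↦ YU A.ω (n + 1)) A.c
  derivative : ∀ (a : V) (n : ℤ), YU (A.Y A.ω 0 a) n = (-(n : ℂ)) • YU a (n - 1)
  /-- the homogeneous subspaces `U(n)` -/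
  gr : ℤ → Submodule ℂ U
  gr_neg : ∀ n < 0, gr n = ⊥
  gr_internal : DirectSum.IsInternal gr
  gr_finiteDimensional : ∀ n, FiniteDimensional ℂ (gr n)
  gr_mode : ∀ (p m n : ℤ), ∀ a ∈ A.weightSpace p, ∀ u ∈ gr n, YU a m u ∈ gr (n + p - m - 1)
  gr_scalar : ∀ n : ℤ, ∃ k : ℂ, ∀ u ∈ gr n, YU A.ω 1 u = k • u

end VertexOperatorAlgebra

/-- The coefficient of `z ^ i` in the Laurent series `(log (1+z)) ^ n * (1+z) ^ (p-1)`. -/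
def bracketCoeff (p n i : ℤ) : ℂ :=
  ((HahnSeries.ofPowerSeries ℤ ℂ (PowerSeries.log ℂ)) ^ n *
    (HahnSeries.ofPowerSeries ℤ ℂ (1 + PowerSeries.X)) ^ (p - 1) : LaurentSeries ℂ).coeff i

lemma order_zpow (x : LaurentSeries ℂ) (n : ℤ) : (x ^ n).order = n * x.order := by
  rcases eq_or_ne x 0 with rfl | hx
  · rcases eq_or_ne n 0 with rfl | hn
    · simp
    · simp [zero_zpow n hn]
  have h : ∀ k : ℕ, (x ^ k).order = k * x.order := fun k ↦ by simp
  rcases n.eq_nat_or_neg with ⟨k, rfl | rfl⟩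
  · simp
  · have h1 := HahnSeries.order_mul (x := x ^ k) (y := (x ^ k)⁻¹) (pow_ne_zero _ hx)
      (inv_ne_zero (pow_ne_zero _ hx))
    rw [mul_inv_cancel₀ (pow_ne_zero _ hx), HahnSeries.order_one, h] at h1
    simp only [zpow_neg, zpow_natCast]
    linarith

lemma order_ofPS (f : PowerSeries ℂ) (k : ℕ) (h0 : ∀ j < k, f.coeff j = 0)
    (h1 : f.coeff k ≠ 0) : (HahnSeries.ofPowerSeries ℤ ℂ f).order = k ∧
      HahnSeries.ofPowerSeries ℤ ℂ f ≠ 0 := by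
  have hk : (HahnSeries.ofPowerSeries ℤ ℂ f).coeff k ≠ 0 := by
    rwa [HahnSeries.ofPowerSeries_apply_coeff]
  have hne : HahnSeries.ofPowerSeries ℤ ℂ f ≠ 0 := by
    intro h; rw [h] at hk; simp at hk
  refine ⟨le_antisymm (HahnSeries.order_le_of_coeff_ne_zero hk) ?_, hne⟩
  by_contra! hlt
  refine (HahnSeries.coeff_order_eq_zero.not.mpr hne) ?_
  rcases lt_or_ge (HahnSeries.ofPowerSeries ℤ ℂ f).order 0 with h | h
  · have := PowerSeries.coeff_coe f (HahnSeries.ofPowerSeries ℤ ℂ f).order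
    rw [if_pos h] at this
    exact this
  · obtain ⟨j, hj⟩ := Int.eq_ofNat_of_zero_le h
    rw [hj, HahnSeries.ofPowerSeries_apply_coeff]
    exact h0 j (by omega)

lemma bracketCoeff_eq_zero (p n i : ℤ) (h : i < n) : bracketCoeff p n i = 0 := by
  obtain ⟨ho, hn⟩ := order_ofPS (PowerSeries.log ℂ) 1 (by simp) (by simp)
  obtain ⟨ho', hn'⟩ := order_ofPS (1 + PowerSeries.X) 0 (by simp) (by simp)
  refine HahnSeries.coeff_eq_zero_of_lt_order ?_
  rw [HahnSeries.order_mul (zpow_ne_zero _ hn) (zpow_ne_zero _ hn'), order_zpow, order_zpow, ho, ho']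
  simpa using h

/-! ## Modular forms for the full modular group -/

/-- The ring `M(Γ(1))` of holomorphic modular forms for `SL(2, ℤ)`, as a ring of functions on the
upper half-plane: the subalgebra generated by the modular forms of all weights. -/
def modularRing : Subalgebra ℂ (ℍ → ℂ) :=
  Algebra.adjoin ℂ {f | ∃ (k : ℤ) (g : ModularForm 𝒮ℒ k), f = g}

/-- `E_k(τ) = (2πi)^(-k) ∑_{(m,n) ≠ (0,0)} (mτ+n)^(-k)` for `k ≥ 3`
(the term at `(0,0)` is `0⁻¹ = 0`). -/
def eisE (k : ℕ) (τ : ℍ) : ℂ :=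
  (∑' v : Fin 2 → ℤ, EisensteinSeries.eisSummand k v τ) / (2 * Real.pi * Complex.I) ^ k

/-- `E_2(τ) = (2πi)^(-2) G_2(τ)`, where `G_2(τ) = ∑_m ∑_n (mτ+n)^(-2)`, summed over `n` first. -/
def eisE2 (τ : ℍ) : ℂ := EisensteinSeries.G2 τ / (2 * Real.pi * Complex.I) ^ 2

lemma eisE_mem (k : ℕ) (hk : 3 ≤ k) : eisE k ∈ modularRing := by
  have h : eisE k = ((2 * riemannZeta k) / (2 * Real.pi * Complex.I) ^ k) •
      (ModularForm.E hk : ℍ → ℂ) := by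
    ext τ
    rw [eisE, tsum_eisSummand_eq_riemannZeta_mul_eisensteinSeries hk,
      Pi.smul_apply, show ModularForm.E hk τ = (1 / 2 : ℂ) • eisensteinSeries (N := 1) 0 k τ from rfl]
    simp only [smul_eq_mul]
    ring
  rw [h]
  have hmem : (ModularForm.E hk : ℍ → ℂ) ∈ modularRing :=
    Algebra.subset_adjoin ⟨(k : ℤ), ModularForm.E hk, rfl⟩
  exact modularRing.smul_mem hmem _

/-- The Eisenstein series `E_{2j}`, for `j = i + 2 ≥ 2`, as an element of `M(Γ(1))`. -/
def eis (i : ℕ) : modularRing := ⟨eisE (2 * (i + 2)), eisE_mem _ (by omega)⟩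

/-- The operator `∂_k f = (2πi)⁻¹ df/dτ + k E_2 f`. -/
def modularDeriv (k : ℂ) (f : ℍ → ℂ) (τ : ℍ) : ℂ :=
  (2 * Real.pi * Complex.I)⁻¹ * deriv (f ∘ UpperHalfPlane.ofComplex) (τ : ℂ) +
    k * eisE2 τ * f τ

namespace VertexOperatorAlgebra.VModule

variable {V U : Type*} [AddCommGroup V] [Module ℂ V] [AddCommGroup U] [Module ℂ U]
  {A : VertexOperatorAlgebra V} (M : A.VModule U)

/-- The module is nonzero and has no proper nonzero submodule. -/
def IsIrreducible : Prop :=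
  Nontrivial U ∧ ∀ N : Submodule ℂ U, (∀ (a : V) (n : ℤ), ∀ u ∈ N, M.YU a n u ∈ N) →
    N = ⊥ ∨ N = ⊤

/-- `r` is the lowest weight: it is an eigenvalue of `L(0)`, and every eigenvalue of `L(0)` is of
the form `r + n` with a natural number `n`. -/
def IsLowestWeight (r : ℂ) : Prop :=
  Module.End.HasEigenvalue (M.YU A.ω 1) r ∧
    ∀ s : ℂ, Module.End.HasEigenvalue (M.YU A.ω 1) s → ∃ n : ℕ, s = r + n

/-- The modes `a[n] u` of the second vertex operator `Y[a, z] = Y(a, e^z - 1) e^{z wt(a)}`: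
for `a` of weight `p`, `a[n] = Res_z Y(a, z) (log (1+z))^n (1+z)^(p-1)`, extended linearly. -/
def bracket (a : V) (n : ℤ) (u : U) : U :=
  ∑ᶠ p : ℤ, ∑ᶠ i : ℤ, bracketCoeff p n i • M.YU (A.component p a) i u

/-- The operators `L[n] = ω̃[n+1]`. -/
def Lbracket (n : ℤ) (u : U) : U := M.bracket A.ωTilde (n + 1) u

/-- The space `U_[k] = {u | L[0] u = k u}`. -/
def bracketWeightSpace (k : ℂ) : Set U := {u | M.Lbracket 0 u = k • u}

/-- `O_q(U)`: the `M(Γ(1))`-submodule of `M(Γ(1)) ⊗ U` generated by the `v[0]u` and the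
`v[-2]u + ∑_{j ≥ 2} (2j-1) E_{2j} ⊗ v[2j-2]u` (with `j = i + 2`). -/
def Oq : Submodule modularRing (modularRing ⊗[ℂ] U) :=
  Submodule.span modularRing
    ({x | ∃ (v : V) (u : U), x = 1 ⊗ₜ[ℂ] M.bracket v 0 u} ∪
     {x | ∃ (v : V) (u : U), x = 1 ⊗ₜ[ℂ] M.bracket v (-2) u +
        ∑ᶠ i : ℕ, (2 * (i + 2) - 1 : ℂ) • (eis i ⊗ₜ[ℂ] M.bracket v (2 * (i + 2) - 2) u)})

lemma exists_bracket_eq_zero (a : V) (u : U) : ∃ N : ℤ, ∀ n, N ≤ n → M.bracket a n u = 0 := by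
  classical
  choose N hN using fun p : ℤ ↦ M.truncated (A.component p a) u
  set x := (LinearEquiv.ofBijective (DirectSum.coeLinearMap A.weightSpace) A.internal).symm a
  obtain ⟨B, hB⟩ := ((x.support.image N).finite_toSet).bddAbove
  refine ⟨B, fun n hn ↦ ?_⟩
  refine (finsum_congr fun p ↦ ?_).trans finsum_zero
  refine (finsum_congr fun i ↦ ?_).trans finsum_zero
  by_cases hp : p ∈ x.support
  · rcases lt_or_ge i n with hi | hi
    · rw [bracketCoeff_eq_zero p n i hi, zero_smul]
    · rw [hN p i ((hB (Finset.mem_coe.mpr (Finset.mem_image_of_mem N hp))).trans (hn.trans hi)),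
        smul_zero]
  · have h0 : A.component p a = 0 := by
      have : x p = 0 := by simpa using hp
      simp only [component]
      exact congrArg Subtype.val this
    rw [h0]
    simp

lemma support_finite (S : (modularRing ⊗[ℂ] U) →ₗ[modularRing] (ℍ → ℂ)) (u : U) (τ : ℍ) :
    (Function.support fun i : ℕ ↦
      eisE (2 * (i + 2)) τ * S (1 ⊗ₜ[ℂ] M.Lbracket (2 * (i + 2) - 2) u) τ).Finite := by
  obtain ⟨N, hN⟩ := M.exists_bracket_eq_zero A.ωTilde u
  refine (Set.finite_Iio N.toNat).subset fun i hi ↦ ?_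
  by_contra h
  refine hi ?_
  have : M.Lbracket (2 * (i + 2) - 2) u = 0 := hN _ (by simp at h; omega)
  simp [this]

lemma modularDeriv_add (k : ℂ) (f g : ℍ → ℂ) (hf : MDifferentiable 𝓘(ℂ) 𝓘(ℂ) f)
    (hg : MDifferentiable 𝓘(ℂ) 𝓘(ℂ) g) (τ : ℍ) :
    modularDeriv k (f + g) τ = modularDeriv k f τ + modularDeriv k g τ := by
  have := congrFun (Derivative.normalizedDerivOfComplex_add f g hf hg) τ
  simp only [Derivative.normalizedDerivOfComplex, Pi.add_apply] at this
  simp only [modularDeriv, this, Pi.add_apply]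
  ring

lemma modularDeriv_smul (k c : ℂ) (f : ℍ → ℂ) (hf : MDifferentiable 𝓘(ℂ) 𝓘(ℂ) f) (τ : ℍ) :
    modularDeriv k (c • f) τ = c * modularDeriv k f τ := by
  have := congrFun (Derivative.normalizedDerivOfComplex_smul c f hf) τ
  simp only [Derivative.normalizedDerivOfComplex, Pi.smul_apply, smul_eq_mul] at this
  simp only [modularDeriv, this, Pi.smul_apply, smul_eq_mul]
  ring

/-- The space `C_1(U)` of one point functions. The `M(Γ(1))`-linearity of `S` is part of its type;
the other conditions are: `S(x, τ)` is holomorphic in `τ`; `S` vanishes on `O_q(U)`; and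
`S(L[-2]u, τ) = ∂_k S(u, τ) + ∑_{j ≥ 2} E_{2j}(τ) S(L[2j-2]u, τ)` for `u ∈ U_[k]`
(with `j = i + 2`), both sides of which are linear in `u`. -/
def C1 : Submodule ℂ ((modularRing ⊗[ℂ] U) →ₗ[modularRing] (ℍ → ℂ)) where
  carrier := {S | (∀ x, MDifferentiable 𝓘(ℂ) 𝓘(ℂ) (S x)) ∧ (∀ x ∈ M.Oq, S x = 0) ∧
    ∀ (k : ℂ), ∀ u ∈ M.bracketWeightSpace k, ∀ τ : ℍ,
      S (1 ⊗ₜ[ℂ] M.Lbracket (-2) u) τ = modularDeriv k (S (1 ⊗ₜ[ℂ] u)) τ +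
        ∑ᶠ i : ℕ, eisE (2 * (i + 2)) τ * S (1 ⊗ₜ[ℂ] M.Lbracket (2 * (i + 2) - 2) u) τ}
  zero_mem' := by
    refine ⟨fun x ↦ mdifferentiable_const, fun x _ ↦ rfl, fun k u _ τ ↦ ?_⟩
    have := modularDeriv_smul k 0 0 (mdifferentiable_const (c := (0 : ℂ))) τ
    simp only [zero_smul, zero_mul] at this
    simp [this]
  add_mem' := by
    rintro S T ⟨hS₁, hS₂, hS₃⟩ ⟨hT₁, hT₂, hT₃⟩
    refine ⟨fun x ↦ (hS₁ x).add (hT₁ x), fun x hx ↦ ?_, fun k u hu τ ↦ ?_⟩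
    · rw [LinearMap.add_apply, hS₂ x hx, hT₂ x hx, add_zero]
    · simp only [LinearMap.add_apply, Pi.add_apply]
      simp only [mul_add (eisE _ τ)]
      rw [hS₃ k u hu τ, hT₃ k u hu τ, modularDeriv_add k _ _ (hS₁ _) (hT₁ _),
        finsum_add_distrib (M.support_finite S u τ) (M.support_finite T u τ)]
      ring
  smul_mem' := by
    rintro c S ⟨hS₁, hS₂, hS₃⟩
    refine ⟨fun x ↦ (hS₁ x).const_smul c, fun x hx ↦ ?_, fun k u hu τ ↦ ?_⟩
    · rw [LinearMap.smul_apply, hS₂ x hx, smul_zero]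
    · simp only [LinearMap.smul_apply, Pi.smul_apply, smul_eq_mul]
      rw [hS₃ k u hu τ, modularDeriv_smul k c _ (hS₁ _), mul_add, mul_finsum]
      simp only [mul_left_comm]

/-- `T` is `S|γ` for `γ = (0 -1; 1 0)`: the `M(Γ(1))`-linear `T` with
`T(u, τ) = (-iτ)^(-t) τ^(t-k) S(u, -1/τ)` for `u ∈ U_[k]` (principal branches of the powers). -/
def IsSlash (t : ℝ) (S T : (modularRing ⊗[ℂ] U) →ₗ[modularRing] (ℍ → ℂ)) : Prop :=
  ∀ (k : ℂ), ∀ u ∈ M.bracketWeightSpace k, ∀ τ : ℍ,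
    T (1 ⊗ₜ[ℂ] u) τ = (-Complex.I * (τ : ℂ)) ^ (-(t : ℂ)) * (τ : ℂ) ^ ((t : ℂ) - k) *
      S (1 ⊗ₜ[ℂ] u) (ModularGroup.S • τ)

end VertexOperatorAlgebra.VModule

end TraceVOA

end

open TraceVOA

open scoped TensorProduct Manifold MatrixGroups UpperHalfPlane

noncomputable section

namespace TraceVOA

/-! ## Residues of vertex operators against Laurent series -/

section Residue

variable {V U W : Type*} [AddCommGroup V] [Module ℂ V] [AddCommGroup U] [Module ℂ U]
  [AddCommGroup W] [Module ℂ W]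

/-! The operator L[0] grades everything, and each defining condition of C_1(U) is homogeneous for
this grading once E_{2j} is given weight 2j and d/dτ weight 2. Passing from τ to -1/τ then
multiplies all terms of a condition by one common automorphy factor.

Two algebraic facts make this work. First, U and V are spanned by L[0]-eigenvectors: with kernel
(1+z) log(1+z) = z + O(z²), L[0] is L(0) plus operators that strictly lower the L(0)-weight, and the
spectrum of L(0) is bounded below (`iSup_eigenspace_of_triangular`, `iSup_eigenspace_residue`). So a
function prescribed on the U_[k] exists and is unique, and conditions need only be tested on
eigenvectors. Second, [L[0], a[n]] = (L[0]a)[n] - (n+1)a[n] (`commutator_bracketL0`), so a[n] shifts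
the weight by p-n-1 when a has L[0]-weight p. The proof inserts the Taylor coefficients of the
kernel into the residue form of the commutator formula (`commutator_residue`). Since ω̃ has
L[0]-weight 2 (`bracketL0_ωTilde`), L[n] lowers weights by n.

On the analytic side, lowering the weight by n multiplies the factor by τ^n (`slashFactor_sub`). For
n = 2j with j ≥ 2 this is the power produced by E_{2j}(-1/τ) = τ^{2j} E_{2j}(τ). For the derivative,
the anomaly of E_2 accounts exactly for the logarithmic derivative -k/τ of the factor
(`modularDeriv_slash`). -/

/-- The linear functionals on Laurent series that vanish on all series of large order. -/
def truncatedFunctionals (U : Type*) [AddCommGroup U] [Module ℂ U] :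
    Submodule ℂ (LaurentSeries ℂ →ₗ[ℂ] U) where
  carrier := {φ | ∃ N : ℤ, ∀ g : LaurentSeries ℂ, (∀ i < N, g.coeff i = 0) → φ g = 0}
  zero_mem' := ⟨0, fun _ _ ↦ rfl⟩
  add_mem' := by
    rintro φ ψ ⟨N, hN⟩ ⟨N', hN'⟩
    refine ⟨max N N', fun g hg ↦ ?_⟩
    rw [LinearMap.add_apply, hN g fun i hi ↦ hg i (by simp [hi]),
      hN' g fun i hi ↦ hg i (by simp [hi]), add_zero]
  smul_mem' := by
    rintro c φ ⟨N, hN⟩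
    exact ⟨N, fun g hg ↦ by rw [LinearMap.smul_apply, hN g hg, smul_zero]⟩

lemma comp_mem_truncatedFunctionals (B : U →ₗ[ℂ] W) {φ : LaurentSeries ℂ →ₗ[ℂ] U}
    (hφ : φ ∈ truncatedFunctionals U) : B ∘ₗ φ ∈ truncatedFunctionals W := by
  obtain ⟨N, hN⟩ := hφ
  exact ⟨N, fun g hg ↦ by rw [LinearMap.comp_apply, hN g hg, map_zero]⟩

lemma coeff_mul_eq_zero (h g : LaurentSeries ℂ) (N i : ℤ) (hg : ∀ i < N, g.coeff i = 0)
    (hi : i < N + h.order) : (h * g).coeff i = 0 := by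
  rw [HahnSeries.coeff_mul]
  refine Finset.sum_eq_zero fun x hx ↦ ?_
  rw [Finset.mem_antidiagonal] at hx
  obtain ⟨hx1, -, hx3⟩ := hx
  rw [hg x.2 (by have := HahnSeries.order_le_of_coeff_ne_zero hx1; omega), mul_zero]

/-- Multiplication by a Laurent series. -/
def laurentMul (h : LaurentSeries ℂ) : LaurentSeries ℂ →ₗ[ℂ] LaurentSeries ℂ where
  toFun g := h * g
  map_add' := mul_add h
  map_smul' c g := by
    rw [RingHom.id_apply, ← HahnSeries.C_mul_eq_smul, ← HahnSeries.C_mul_eq_smul, mul_left_comm]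

lemma laurentMul_apply (h g : LaurentSeries ℂ) : laurentMul h g = h * g := rfl

lemma mul_mem_truncatedFunctionals (h : LaurentSeries ℂ) {φ : LaurentSeries ℂ →ₗ[ℂ] U}
    (hφ : φ ∈ truncatedFunctionals U) :
    φ ∘ₗ laurentMul h ∈ truncatedFunctionals U := by
  obtain ⟨N, hN⟩ := hφ
  refine ⟨N - h.order, fun g hg ↦ ?_⟩
  rw [LinearMap.comp_apply, laurentMul_apply]
  exact hN _ fun i hi ↦ coeff_mul_eq_zero h g _ i hg (by omega)

lemma hasseDeriv_mem_truncatedFunctionals (l : ℕ) {φ : LaurentSeries ℂ →ₗ[ℂ] U}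
    (hφ : φ ∈ truncatedFunctionals U) :
    φ ∘ₗ LaurentSeries.hasseDeriv ℂ l ∈ truncatedFunctionals U := by
  obtain ⟨N, hN⟩ := hφ
  refine ⟨N + l, fun g hg ↦ ?_⟩
  rw [LinearMap.comp_apply]
  refine hN _ fun i hi ↦ ?_
  rw [LaurentSeries.hasseDeriv_coeff, hg _ (by omega), smul_zero]

/-- A Laurent series has finitely many terms of exponent below any N, and the difference of the two
functionals kills the rest for a suitable N. This reduces identities between residues to identities
between single modes. -/
lemma truncatedFunctionals_ext {φ ψ : LaurentSeries ℂ →ₗ[ℂ] U} (hφ : φ ∈ truncatedFunctionals U)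
    (hψ : ψ ∈ truncatedFunctionals U)
    (h : ∀ j : ℤ, φ (HahnSeries.single j 1) = ψ (HahnSeries.single j 1)) : φ = ψ := by
  obtain ⟨N, hN⟩ := Submodule.sub_mem _ hφ hψ
  ext g
  rw [← sub_eq_zero, ← LinearMap.sub_apply]
  have hs : (φ - ψ) (∑ i ∈ Finset.Ico g.order N, HahnSeries.single i (g.coeff i)) = 0 := by
    rw [map_sum]
    refine Finset.sum_eq_zero fun i _ ↦ ?_
    have : (HahnSeries.single i (g.coeff i) : LaurentSeries ℂ) =
        g.coeff i • HahnSeries.single i 1 := by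
      ext k
      simp [HahnSeries.coeff_single]
    rw [this, map_smul, LinearMap.sub_apply, h, sub_self, smul_zero]
  suffices (φ - ψ) (g - ∑ i ∈ Finset.Ico g.order N, HahnSeries.single i (g.coeff i)) = 0 by
    rwa [map_sub, hs, sub_zero] at this
  refine hN _ fun i hi ↦ ?_
  rw [HahnSeries.coeff_sub, HahnSeries.coeff_sum]
  by_cases hm : i ∈ Finset.Ico g.order N
  · rw [Finset.sum_eq_single_of_mem i hm fun b _ hb ↦ HahnSeries.coeff_single_of_ne hb.symm,
      HahnSeries.coeff_single_same, sub_self]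
  · rw [Finset.sum_eq_zero fun b hb ↦ HahnSeries.coeff_single_of_ne (by rintro rfl; exact hm hb),
      sub_zero]
    exact HahnSeries.coeff_eq_zero_of_lt_order (by simp at hm; omega)

lemma residue_support_finite {YU : V →ₗ[ℂ] ℤ → Module.End ℂ U} (h : Truncated YU) (a : V)
    (g : LaurentSeries ℂ) (u : U) :
    (Function.support fun i : ℤ ↦ g.coeff i • YU a i u).Finite := by
  obtain ⟨N, hN⟩ := h a u
  refine (Set.finite_Ico g.order N).subset fun i hi ↦ ⟨?_, ?_⟩
  · by_contra! hlt
    exact hi (by simp [HahnSeries.coeff_eq_zero_of_lt_order hlt])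
  · by_contra! hle
    exact hi (by simp [hN i hle])

/-- The residue `Res_z Y(a, z) g(z) = ∑ gᵢ a(i)` of a vertex operator against a Laurent series. -/
def residue (YU : V →ₗ[ℂ] ℤ → Module.End ℂ U) (h : Truncated YU) :
    V →ₗ[ℂ] LaurentSeries ℂ →ₗ[ℂ] Module.End ℂ U :=
  LinearMap.mk₂ ℂ
    (fun a g ↦
      { toFun := fun u ↦ ∑ᶠ i : ℤ, g.coeff i • YU a i u
        map_add' := fun u w ↦ by
          rw [← finsum_add_distrib (residue_support_finite h a g u)
            (residue_support_finite h a g w)]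
          simp only [map_add, smul_add]
        map_smul' := fun c u ↦ by
          rw [RingHom.id_apply, smul_finsum]
          simp only [map_smul, smul_comm c] })
    (fun a b g ↦ by
      ext u
      simp only [LinearMap.coe_mk, AddHom.coe_mk, LinearMap.add_apply]
      rw [← finsum_add_distrib (residue_support_finite h a g u) (residue_support_finite h b g u)]
      simp only [map_add, Pi.add_apply, LinearMap.add_apply, smul_add])
    (fun c a g ↦ by
      ext u
      simp only [LinearMap.coe_mk, AddHom.coe_mk, LinearMap.smul_apply]
      rw [smul_finsum]
      simp only [map_smul, Pi.smul_apply, LinearMap.smul_apply, smul_comm c])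
    (fun a g g' ↦ by
      ext u
      simp only [LinearMap.coe_mk, AddHom.coe_mk, LinearMap.add_apply]
      rw [← finsum_add_distrib (residue_support_finite h a g u) (residue_support_finite h a g' u)]
      simp only [HahnSeries.coeff_add, add_smul])
    (fun c a g ↦ by
      ext u
      simp only [LinearMap.coe_mk, AddHom.coe_mk, LinearMap.smul_apply]
      rw [smul_finsum]
      simp only [HahnSeries.coeff_smul, smul_eq_mul, mul_smul])

variable {YU : V →ₗ[ℂ] ℤ → Module.End ℂ U} (h : Truncated YU)

lemma residue_apply (a : V) (g : LaurentSeries ℂ) (u : U) :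
    residue YU h a g u = ∑ᶠ i : ℤ, g.coeff i • YU a i u := rfl

lemma residue_single (a : V) (j : ℤ) (c : ℂ) :
    residue YU h a (HahnSeries.single j c) = c • YU a j := by
  ext u
  rw [residue_apply, finsum_eq_single _ j]
  · simp
  · intro i hi
    simp [HahnSeries.coeff_single_of_ne hi]

lemma residue_flip_mem_truncatedFunctionals (a : V) (u : U) :
    (residue YU h a).flip u ∈ truncatedFunctionals U := by
  obtain ⟨N, hN⟩ := h a u
  refine ⟨N, fun g hg ↦ ?_⟩
  rw [LinearMap.flip_apply, residue_apply]
  refine (finsum_congr fun i ↦ ?_).trans finsum_zero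
  rcases lt_or_ge i N with hi | hi
  · rw [hg i hi, zero_smul]
  · rw [hN i hi, smul_zero]

/-- This is the Jacobi identity with l = 0: the coefficients C(0,i) vanish for i > 0, so the right
side collapses to the commutator. -/
lemma commutator_modes {Y : V →ₗ[ℂ] ℤ → Module.End ℂ V} (hJ : JacobiIdentity Y YU) (a b : V)
    (u : U) (m n : ℤ) {K : ℕ} (hK : ∀ l : ℕ, K ≤ l → Y a l b = 0) :
    YU a m (YU b n u) - YU b n (YU a m u) =
      ∑ l ∈ Finset.range K, ((Ring.choose m l : ℤ) : ℂ) • YU (Y a l b) (m + n - l) u := by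
  have := hJ a b u 0 m n
  rw [finsum_eq_single (α := ℕ) (fun i ↦ ((-1 : ℂ) ^ i * ((Ring.choose (0 : ℤ) i : ℤ) : ℂ)) •
      (YU a (m + 0 - i) (YU b (n + i) u) - (-1 : ℂ) ^ (0 : ℤ) • YU b (n + 0 - i) (YU a (m + i) u)))
      0 (fun i hi ↦ by rw [Ring.choose_zero_pos ℤ (Nat.pos_of_ne_zero hi)]; simp)] at this
  simp only [pow_zero, Ring.choose_zero_right, Int.cast_one, mul_one, add_zero, Nat.cast_zero,
    sub_zero, zpow_zero, one_smul, zero_add] at this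
  rw [← this]
  refine finsum_eq_sum_of_support_subset _ fun l hl ↦ ?_
  by_contra hl'
  exact hl (by simp [hK l (by simpa using hl')])

/-- The commutator formula `[Res Y(a,z)f(z), Res Y(b,z)g(z)] = ∑ₗ Res Y(a(l)b,z) f⁽ˡ⁾(z)/l! g(z)`. -/
theorem commutator_residue {Y : V →ₗ[ℂ] ℤ → Module.End ℂ V} (hJ : JacobiIdentity Y YU) (a b : V)
    {K : ℕ} (hK : ∀ l : ℕ, K ≤ l → Y a l b = 0) (f g : LaurentSeries ℂ) (u : U) :
    residue YU h a f (residue YU h b g u) - residue YU h b g (residue YU h a f u) =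
      ∑ l ∈ Finset.range K,
        residue YU h (Y a l b) (LaurentSeries.hasseDeriv ℂ l f * g) u := by
  -- With f = z^m fixed, both sides are truncated functionals of g, so monomials g suffice, and
  -- there the claim is `commutator_modes`.
  have step (m : ℤ) (g : LaurentSeries ℂ) :
      residue YU h a (HahnSeries.single m 1) (residue YU h b g u) -
        residue YU h b g (residue YU h a (HahnSeries.single m 1) u) =
      ∑ l ∈ Finset.range K, residue YU h (Y a l b)
        (LaurentSeries.hasseDeriv ℂ l (HahnSeries.single m 1) * g) u := by
    have := truncatedFunctionals_ext
      (φ := residue YU h a (HahnSeries.single m 1) ∘ₗ (residue YU h b).flip u -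
        (residue YU h b).flip (residue YU h a (HahnSeries.single m 1) u))
      (ψ := ∑ l ∈ Finset.range K, (residue YU h (Y a l b)).flip u ∘ₗ
        laurentMul (LaurentSeries.hasseDeriv ℂ l (HahnSeries.single m 1)))
      (Submodule.sub_mem _
        (comp_mem_truncatedFunctionals _ (residue_flip_mem_truncatedFunctionals h b u))
        (residue_flip_mem_truncatedFunctionals h b _))
      (Submodule.sum_mem _ fun l _ ↦
        mul_mem_truncatedFunctionals _ (residue_flip_mem_truncatedFunctionals h _ u))
      (fun n ↦ by
        simp only [LinearMap.sub_apply, LinearMap.comp_apply, LinearMap.flip_apply,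
          LinearMap.sum_apply, laurentMul_apply, LaurentSeries.hasseDeriv_single,
          HahnSeries.single_mul_single, residue_single, one_smul, mul_one, zsmul_eq_mul,
          LinearMap.smul_apply]
        rw [commutator_modes hJ a b u m n hK]
        refine Finset.sum_congr rfl fun l _ ↦ ?_
        rw [show m - l + n = m + n - l by ring])
    simpa [laurentMul_apply] using LinearMap.congr_fun this g
  -- Now g is fixed and both sides are truncated functionals of f.
  have := truncatedFunctionals_ext
    (φ := (residue YU h a).flip (residue YU h b g u) -
      residue YU h b g ∘ₗ (residue YU h a).flip u)
    (ψ := ∑ l ∈ Finset.range K, ((residue YU h (Y a l b)).flip u ∘ₗ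
      laurentMul g) ∘ₗ LaurentSeries.hasseDeriv ℂ l)
    (Submodule.sub_mem _ (residue_flip_mem_truncatedFunctionals h a _)
      (comp_mem_truncatedFunctionals _ (residue_flip_mem_truncatedFunctionals h a u)))
    (Submodule.sum_mem _ fun l _ ↦ hasseDeriv_mem_truncatedFunctionals _
      (mul_mem_truncatedFunctionals _ (residue_flip_mem_truncatedFunctionals h _ u)))
    (fun m ↦ by
      simp only [LinearMap.sub_apply, LinearMap.comp_apply, LinearMap.flip_apply,
        LinearMap.sum_apply, laurentMul_apply]
      rw [step m g]
      simp only [mul_comm g])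
  have h2 := LinearMap.congr_fun this f
  simp only [LinearMap.sub_apply, LinearMap.comp_apply, LinearMap.flip_apply,
    LinearMap.sum_apply, laurentMul_apply] at h2
  rw [h2]
  simp only [mul_comm g]

/-- Integration by parts: if `Y(b, z) = d/dz Y(a, z)`, then
`Res Y(b, z) g(z) = - Res Y(a, z) g'(z)`. -/
lemma residue_derivative (a b : V) (hab : ∀ n : ℤ, YU b n = (-(n : ℂ)) • YU a (n - 1))
    (g : LaurentSeries ℂ) :
    residue YU h b g = -residue YU h a (LaurentSeries.derivative ℂ g) := by
  ext u
  have := truncatedFunctionals_ext (φ := (residue YU h b).flip u)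
    (ψ := -((residue YU h a).flip u ∘ₗ LaurentSeries.hasseDeriv ℂ 1))
    (residue_flip_mem_truncatedFunctionals h b u)
    (Submodule.neg_mem _ (hasseDeriv_mem_truncatedFunctionals _
      (residue_flip_mem_truncatedFunctionals h a u)))
    (fun j ↦ by
      simp only [LinearMap.flip_apply, LinearMap.neg_apply, LinearMap.comp_apply,
        LaurentSeries.hasseDeriv_single, residue_single, hab, one_smul, Ring.choose_one_right]
      simp)
  exact LinearMap.congr_fun this g

end Residue

/-! ## The Laurent series `(log (1+z)) ^ n * (1+z) ^ (p-1)` -/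

section Series

lemma coeff_mem_truncatedFunctionals (k : ℤ) :
    (HahnSeries.coeff.linearMap k : LaurentSeries ℂ →ₗ[ℂ] ℂ) ∈ truncatedFunctionals ℂ :=
  ⟨k + 1, fun _ hg ↦ hg k (by omega)⟩

/-- Leibniz rule for Laurent series. -/
lemma laurent_leibniz (f g : LaurentSeries ℂ) :
    LaurentSeries.hasseDeriv ℂ 1 (f * g) =
      LaurentSeries.hasseDeriv ℂ 1 f * g + f * LaurentSeries.hasseDeriv ℂ 1 g := by
  ext k
  let D := LaurentSeries.hasseDeriv (V := ℂ) ℂ 1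
  let C : LaurentSeries ℂ →ₗ[ℂ] ℂ := HahnSeries.coeff.linearMap k
  have hC : C ∈ truncatedFunctionals ℂ := coeff_mem_truncatedFunctionals k
  have mem (h : LaurentSeries ℂ) : (C ∘ₗ D) ∘ₗ laurentMul h - C ∘ₗ laurentMul (D h) -
      (C ∘ₗ laurentMul h) ∘ₗ D ∈ truncatedFunctionals ℂ :=
    Submodule.sub_mem _ (Submodule.sub_mem _
      (mul_mem_truncatedFunctionals h (hasseDeriv_mem_truncatedFunctionals 1 hC))
      (mul_mem_truncatedFunctionals _ hC))
      (hasseDeriv_mem_truncatedFunctionals 1 (mul_mem_truncatedFunctionals _ hC))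
  have apply (h g : LaurentSeries ℂ) : ((C ∘ₗ D) ∘ₗ laurentMul h - C ∘ₗ laurentMul (D h) -
      (C ∘ₗ laurentMul h) ∘ₗ D) g = C (D (h * g) - D h * g - h * D g) := by
    simp [laurentMul_apply]
  -- As a truncated functional of one factor at a time, the Leibniz defect need only vanish on pairs
  -- of monomials; `key` then frees the other factor.
  have step (m : ℤ) (g : LaurentSeries ℂ) : C (D (HahnSeries.single m 1 * g) -
      D (HahnSeries.single m 1) * g - HahnSeries.single m 1 * D g) = 0 := by
    rw [← apply]
    refine LinearMap.congr_fun (truncatedFunctionals_ext (mem _) (Submodule.zero_mem _)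
      fun n ↦ ?_) g
    rw [apply, LinearMap.zero_apply]
    simp only [D, LaurentSeries.hasseDeriv_single, HahnSeries.single_mul_single]
    simp only [Nat.cast_one, Ring.choose_one_right, zsmul_eq_mul, Int.cast_add, mul_one, one_mul]
    rw [show m - 1 + n = m + n - 1 by ring, show m + (n - 1) = m + n - 1 by ring,
      HahnSeries.single_add, add_sub_cancel_left, sub_self, map_zero]
  have key : C (D (g * f) - D g * f - g * D f) = 0 := by
    rw [← apply]
    refine LinearMap.congr_fun (truncatedFunctionals_ext (mem _) (Submodule.zero_mem _)
      fun n ↦ ?_) f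
    rw [apply, LinearMap.zero_apply, ← step n g]
    rw [sub_sub, sub_sub, mul_comm g, mul_comm (D g), mul_comm g,
      add_comm (HahnSeries.single n 1 * D g)]
  rw [show D (g * f) - D g * f - g * D f = D (f * g) - (D f * g + f * D g) by
      rw [mul_comm g f, sub_sub, mul_comm (D g), mul_comm g (D f), add_comm (f * D g)],
    map_sub, sub_eq_zero] at key
  exact key

/-- The derivation `d/dz` of the field of Laurent series. -/
def laurentDerivation : Derivation ℤ (LaurentSeries ℂ) (LaurentSeries ℂ) :=
  { toFun := LaurentSeries.hasseDeriv ℂ 1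
    map_add' := map_add _
    map_smul' := fun c f ↦ by
      have hc : LaurentSeries.hasseDeriv ℂ 1 ((c : ℤ) : LaurentSeries ℂ) = 0 := by
        rw [← map_intCast HahnSeries.C, HahnSeries.C_apply, LaurentSeries.hasseDeriv_single]
        simp
      simp only [Algebra.smul_def, eq_intCast, Int.cast_id]
      rw [laurent_leibniz, hc, zero_mul, zero_add]
      exact (zsmul_eq_mul _ _).symm
    map_one_eq_zero' := by
      ext n
      simp only [LinearMap.coe_mk, AddHom.coe_mk, LaurentSeries.hasseDeriv_coeff,
        HahnSeries.coeff_one, HahnSeries.coeff_zero]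
      split_ifs with h0
      · simp_all
      · simp
    leibniz' := fun f g ↦ by
      simp only [smul_eq_mul]
      refine (laurent_leibniz f g).trans ?_
      rw [add_comm, mul_comm g]
      rfl }

lemma laurentDerivation_apply (f : LaurentSeries ℂ) :
    laurentDerivation f = LaurentSeries.hasseDeriv ℂ 1 f := rfl

/-- The Laurent series `(log (1+z)) ^ n * (1+z) ^ (p-1)`. -/
def bracketSeries (p n : ℤ) : LaurentSeries ℂ :=
  (HahnSeries.ofPowerSeries ℤ ℂ (PowerSeries.log ℂ)) ^ n *
    (HahnSeries.ofPowerSeries ℤ ℂ (1 + PowerSeries.X)) ^ (p - 1)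

lemma bracketCoeff_eq (p n i : ℤ) : bracketCoeff p n i = (bracketSeries p n).coeff i := rfl

lemma log_ne_zero : HahnSeries.ofPowerSeries ℤ ℂ (PowerSeries.log ℂ) ≠ 0 :=
  (order_ofPS (PowerSeries.log ℂ) 1 (by simp) (by simp)).2

lemma one_add_X_ne_zero : HahnSeries.ofPowerSeries ℤ ℂ (1 + PowerSeries.X) ≠ 0 :=
  (order_ofPS (1 + PowerSeries.X) 0 (by simp) (by simp)).2

lemma bracketSeries_mul (p q m n : ℤ) :
    bracketSeries p m * bracketSeries q n = bracketSeries (p + q - 1) (m + n) := by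
  simp only [bracketSeries]
  rw [show p + q - 1 - 1 = (p - 1) + (q - 1) by ring, zpow_add₀ log_ne_zero,
    zpow_add₀ one_add_X_ne_zero]
  ring

lemma laurentDerivation_ofPowerSeries (f : PowerSeries ℂ) :
    laurentDerivation (HahnSeries.ofPowerSeries ℤ ℂ f) =
      HahnSeries.ofPowerSeries ℤ ℂ (PowerSeries.derivative ℂ f) := by
  ext n
  rw [laurentDerivation_apply, LaurentSeries.hasseDeriv_coeff]
  rcases lt_or_ge n 0 with hn | hn
  · rw [PowerSeries.coeff_coe, PowerSeries.coeff_coe, if_pos hn]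
    -- At n = -1 the constant term of f is involved, but its factor n + 1 is zero.
    rcases eq_or_ne n (-1) with rfl | hn'
    · simp
    · rw [if_pos (by push_cast; omega), smul_zero]
  · lift n to ℕ using hn
    rw [← Nat.cast_add, HahnSeries.ofPowerSeries_apply_coeff, HahnSeries.ofPowerSeries_apply_coeff,
      PowerSeries.coeff_derivative]
    simp [mul_comm]

lemma laurentDerivation_one_add_X :
    laurentDerivation (HahnSeries.ofPowerSeries ℤ ℂ (1 + PowerSeries.X)) = 1 := by
  rw [laurentDerivation_ofPowerSeries]
  simp

lemma laurentDerivation_log :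
    laurentDerivation (HahnSeries.ofPowerSeries ℤ ℂ (PowerSeries.log ℂ)) =
      (HahnSeries.ofPowerSeries ℤ ℂ (1 + PowerSeries.X))⁻¹ := by
  refine eq_inv_of_mul_eq_one_left ?_
  rw [laurentDerivation_ofPowerSeries, ← map_mul, ← map_one (HahnSeries.ofPowerSeries ℤ ℂ)]
  congr 1
  rw [PowerSeries.deriv_log]
  ext n
  rcases n with - | n
  · simp [mul_add]
  · rw [mul_add, mul_one, map_add, PowerSeries.coeff_succ_mul_X]
    simp [pow_succ, PowerSeries.coeff_one]

/-- Differentiating the logarithm and differentiating the power each cost one factor 1+z, which is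
why both terms carry the index p - 1. -/
lemma laurentDerivation_bracketSeries (p n : ℤ) :
    laurentDerivation (bracketSeries p n) =
      (n : LaurentSeries ℂ) * bracketSeries (p - 1) (n - 1) +
        ((p : LaurentSeries ℂ) - 1) * bracketSeries (p - 1) n := by
  rw [bracketSeries, Derivation.leibniz, Derivation.leibniz_zpow,
    Derivation.leibniz_zpow, laurentDerivation_one_add_X, laurentDerivation_log]
  simp only [bracketSeries, smul_eq_mul, zsmul_eq_mul, mul_one]
  rw [zpow_sub_one₀ one_add_X_ne_zero (p - 1)]
  push_cast
  ring

/-- The coefficients of `(1+z) log (1+z)`. -/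
lemma bracketSeries_two_one_coeff (n : ℕ) : (bracketSeries 2 1).coeff ((n + 2 : ℕ) : ℤ) =
    (-1) ^ n / ((n + 1) * (n + 2)) := by
  have : bracketSeries 2 1 =
      HahnSeries.ofPowerSeries ℤ ℂ (PowerSeries.log ℂ * (1 + PowerSeries.X)) := by
    rw [map_mul, bracketSeries]
    norm_num
  rw [this, HahnSeries.ofPowerSeries_apply_coeff, mul_add, mul_one, map_add,
    PowerSeries.coeff_succ_mul_X, PowerSeries.coeff_log, PowerSeries.coeff_log]
  have h1 : (n + 1 : ℂ) ≠ 0 := by exact_mod_cast n.succ_ne_zero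
  have h2 : (n + 2 : ℂ) ≠ 0 := by exact_mod_cast (n + 1).succ_ne_zero
  simp [pow_succ]
  field_simp
  ring

lemma bracketSeries_two_one_coeff_one : (bracketSeries 2 1).coeff 1 = 1 := by
  have : bracketSeries 2 1 =
      HahnSeries.ofPowerSeries ℤ ℂ (PowerSeries.log ℂ * (1 + PowerSeries.X)) := by
    rw [map_mul, bracketSeries]
    norm_num
  rw [this, show (1 : ℤ) = ((1 : ℕ) : ℤ) from rfl, HahnSeries.ofPowerSeries_apply_coeff, mul_add,
    mul_one, map_add, PowerSeries.coeff_succ_mul_X]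
  simp

lemma bracketSeries_two_one_coeff_of_nonpos {i : ℤ} (hi : i ≤ 0) :
    (bracketSeries 2 1).coeff i = 0 :=
  bracketCoeff_eq_zero 2 1 i (by omega)

/-- The recursion that yields all Hasse derivatives of a series from repeated use of d/dz. -/
lemma hasseDeriv_succ (l : ℕ) (f : LaurentSeries ℂ) :
    ((l : LaurentSeries ℂ) + 1) * LaurentSeries.hasseDeriv ℂ (l + 1) f =
      laurentDerivation (LaurentSeries.hasseDeriv ℂ l f) := by
  rw [laurentDerivation_apply, LaurentSeries.hasseDeriv_comp, Nat.choose_one_right, add_comm 1 l,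
    nsmul_eq_mul]
  push_cast
  rfl

lemma laurentDerivation_C (c : ℂ) : laurentDerivation (HahnSeries.C c) = 0 := by
  rw [laurentDerivation_apply, HahnSeries.C_apply, LaurentSeries.hasseDeriv_single]
  simp

/-- The Hasse derivatives of `(1+z) log (1+z)`. -/
lemma hasseDeriv_bracketSeries_two_one (l : ℕ) :
    LaurentSeries.hasseDeriv ℂ l (bracketSeries 2 1) =
      HahnSeries.C ((bracketSeries 2 1).coeff l) * bracketSeries (2 - l) 0 +
        (if l = 0 then bracketSeries 2 1 else 0) + if l = 1 then bracketSeries 1 1 else 0 := by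
  match l with
  | 0 => simp [bracketSeries_two_one_coeff_of_nonpos]
  | 1 =>
    rw [← laurentDerivation_apply, laurentDerivation_bracketSeries]
    simp [bracketSeries_two_one_coeff_one]
    norm_num
  | n + 2 =>
    rw [bracketSeries_two_one_coeff]
    simp only [Nat.add_eq_zero_iff, OfNat.ofNat_ne_zero, and_false, if_false, add_zero,
      Nat.reduceEqDiff]
    -- The first derivative is 1 + log(1+z). From the second on the logarithm is gone and only a
    -- multiple of (1+z)^(1-l) remains; the constants satisfy (n+3)c_{n+3} = -(n+1)c_{n+2}.
    induction n with
    | zero =>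
      have := hasseDeriv_succ 1 (bracketSeries 2 1)
      rw [← laurentDerivation_apply, laurentDerivation_bracketSeries] at this
      norm_num [laurentDerivation_bracketSeries] at this
      have two_ne : (2 : LaurentSeries ℂ) ≠ 0 := by
        rw [← map_ofNat HahnSeries.C 2]
        exact (map_ne_zero _).mpr two_ne_zero
      rw [show ((-1) ^ 0 / ((((0 : ℕ) : ℂ) + 1) * (((0 : ℕ) : ℂ) + 2)) : ℂ) = 2⁻¹ by norm_num,
        map_inv₀, map_ofNat, show (2 - ((0 + 2 : ℕ) : ℤ)) = 0 by norm_num, ← this,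
        inv_mul_cancel_left₀ two_ne]
    | succ n ih =>
      have := hasseDeriv_succ (n + 2) (bracketSeries 2 1)
      rw [ih, Derivation.leibniz, laurentDerivation_C, laurentDerivation_bracketSeries] at this
      have h3 : (n + 3 : ℂ) ≠ 0 := by exact_mod_cast (n + 2).succ_ne_zero
      have h2 : (n + 2 : ℂ) ≠ 0 := by exact_mod_cast (n + 1).succ_ne_zero
      have h1 : (n + 1 : ℂ) ≠ 0 := by exact_mod_cast n.succ_ne_zero
      have h4 : (((n + 2 : ℕ) : LaurentSeries ℂ) + 1) = HahnSeries.C (n + 3 : ℂ) := by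
        rw [map_add, map_natCast, map_ofNat]; push_cast; ring
      have h5 : (((2 - ((n + 2 : ℕ) : ℤ) : ℤ) : LaurentSeries ℂ) - 1) =
          HahnSeries.C (-(n + 1) : ℂ) := by
        rw [map_neg, map_add, map_natCast, map_one]; push_cast; ring
      refine mul_left_cancel₀ (b := LaurentSeries.hasseDeriv ℂ (n + 2 + 1) (bracketSeries 2 1))
        ((map_ne_zero HahnSeries.C).mpr h3) ?_
      rw [← h4, this, h4, h5, show (2 - ((n + 1 + 2 : ℕ) : ℤ)) = 2 - ((n + 2 : ℕ) : ℤ) - 1 by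
        push_cast; ring]
      simp only [Int.cast_zero, zero_mul, zero_add, mul_zero, add_zero, smul_eq_mul]
      rw [← mul_assoc, ← mul_assoc, ← map_mul, ← map_mul]
      congr 2
      push_cast
      rw [pow_succ, add_assoc (n : ℂ) 1 1, add_assoc (n : ℂ) 1 2, one_add_one_eq_two,
        show (1 : ℂ) + 2 = 3 by norm_num]
      field_simp

end Series

/-! ## Semisimplicity of `L[0]` -/

/-- A locally finite triangular perturbation of a diagonalizable operator with spectrum in
`r + ℕ` is diagonalizable. -/
theorem iSup_eigenspace_of_triangular {E : Type*} [AddCommGroup E] [Module ℂ E]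
    (D N : Module.End ℂ E) (r : ℂ) (hneg : ∀ n : ℤ, n < 0 → D.eigenspace (r + n) = ⊥)
    (htop : ⨆ n : ℤ, D.eigenspace (r + n) = ⊤)
    (hN : ∀ n : ℤ, ∀ u ∈ D.eigenspace (r + n),
      N u - (r + n) • u ∈ ⨆ (j : ℤ) (_ : j < n), D.eigenspace (r + j)) :
    ⨆ k, N.eigenspace k = ⊤ := by
  have key (n : ℕ) : ⨆ (j : ℤ) (_ : j < n), D.eigenspace (r + j) ≤
      ⨆ (j : ℤ) (_ : j < n), N.eigenspace (r + j) := by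
    induction n with
    | zero => exact iSup₂_le fun j hj ↦ by rw [hneg j (by exact_mod_cast hj)]; exact bot_le
    | succ n ih =>
      have mono : ⨆ (j : ℤ) (_ : j < n), N.eigenspace (r + j) ≤
          ⨆ (j : ℤ) (_ : j < (n + 1 : ℕ)), N.eigenspace (r + j) :=
        iSup₂_le fun j hj ↦ le_iSup₂_of_le j (by push_cast; omega) le_rfl
      refine iSup₂_le fun j hj ↦ ?_
      rcases lt_or_eq_of_le (show j ≤ n by push_cast at hj; omega) with hj' | rfl
      · exact ((le_iSup₂_of_le j hj' le_rfl).trans ih).trans mono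
      · intro u hu
        -- On the eigenspaces of N below level n, the operator N - (r+n) acts by the nonzero scalars
        -- j - n, so it is onto their sum.
        have surj : ⨆ (j : ℤ) (_ : j < n), N.eigenspace (r + j) ≤
            (⨆ (j : ℤ) (_ : j < n), N.eigenspace (r + j)).map
              (N - algebraMap ℂ (Module.End ℂ E) (r + (n : ℤ))) := by
          refine iSup₂_le fun j hj x hx ↦
            ⟨((j : ℂ) - n)⁻¹ • x, Submodule.smul_mem _ _ ?_, ?_⟩
          · exact Submodule.mem_iSup_of_mem j (Submodule.mem_iSup_of_mem hj hx)
          · have hne : (j : ℂ) - n ≠ 0 := by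
              rw [sub_ne_zero]
              exact_mod_cast hj.ne
            rw [map_smul, LinearMap.sub_apply, Module.End.mem_eigenspace_iff.mp hx,
              Module.algebraMap_end_apply, ← sub_smul, smul_smul]
            rw [show (r + j - (r + ((n : ℤ) : ℂ))) = j - n by push_cast; ring,
              inv_mul_cancel₀ hne, one_smul]
        -- The error of u is also the error of some w from lower levels, so u - w is a genuine
        -- eigenvector of N for r + n.
        obtain ⟨w, hw, hw'⟩ := surj (ih (hN n u hu))
        rw [← sub_add_cancel u w]
        refine Submodule.add_mem _ ?_ (mono hw)
        refine Submodule.mem_iSup_of_mem (n : ℤ) (Submodule.mem_iSup_of_mem (by push_cast; omega) ?_)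
        rw [Module.End.mem_eigenspace_iff, map_sub, smul_sub]
        rw [LinearMap.sub_apply, Module.algebraMap_end_apply] at hw'
        rw [sub_eq_sub_iff_sub_eq_sub, hw']
  rw [eq_top_iff, ← htop]
  refine iSup_le fun n ↦ ?_
  rcases lt_or_ge n 0 with hn | hn
  · rw [hneg n hn]; exact bot_le
  · lift n to ℕ using hn
    calc D.eigenspace (r + (n : ℤ)) ≤ ⨆ (j : ℤ) (_ : j < (n + 1 : ℕ)), D.eigenspace (r + j) :=
          le_iSup₂_of_le (n : ℤ) (by push_cast; omega) le_rfl
      _ ≤ _ := key (n + 1)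
      _ ≤ _ := iSup₂_le fun j _ ↦ le_iSup N.eigenspace (r + j)

section Virasoro

variable {V U : Type*} [AddCommGroup V] [Module ℂ V] [AddCommGroup U] [Module ℂ U]

lemma virasoro_weight {L : ℤ → Module.End ℂ U} {c : ℂ} (hL : VirasoroRelations L c) (n : ℤ)
    {k : ℂ} {u : U} (hu : u ∈ (L 0).eigenspace k) : L n u ∈ (L 0).eigenspace (k - n) := by
  rw [Module.End.mem_eigenspace_iff] at hu ⊢
  have := LinearMap.congr_fun (hL 0 n) u
  -- The central term carries the factor m³ - m, which vanishes for m = 0 even when n = 0.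
  have h0 : (if 0 + n = 0 then ((((0 : ℤ) : ℂ) ^ 3 - ((0 : ℤ) : ℂ)) / 12 * c) •
      (1 : Module.End ℂ U) else 0) = 0 := by
    split_ifs <;> simp
  rw [h0] at this
  simp only [LinearMap.sub_apply, Module.End.mul_apply, LinearMap.smul_apply,
    hu, map_smul, zero_add, add_zero, Int.cast_zero, zero_sub] at this
  rw [sub_eq_iff_eq_add.mp this, ← add_smul]
  congr 1
  ring

variable {YU : V →ₗ[ℂ] ℤ → Module.End ℂ U} (h : Truncated YU)

/-- `L[0] = Res_z Y(ω, z) (1+z) log (1+z)` is diagonalizable when `L(0)` is, with spectrum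
in `r + ℕ`. -/
theorem iSup_eigenspace_residue {ω : V} {c : ℂ}
    (hL : VirasoroRelations (fun n ↦ YU ω (n + 1)) c) (r : ℂ)
    (hneg : ∀ n : ℤ, n < 0 → (YU ω 1).eigenspace (r + n) = ⊥)
    (htop : ⨆ n : ℤ, (YU ω 1).eigenspace (r + n) = ⊤) :
    ⨆ k, (residue YU h ω (bracketSeries 2 1)).eigenspace k = ⊤ := by
  refine iSup_eigenspace_of_triangular (YU ω 1) _ r hneg htop fun n u hu ↦ ?_
  -- Splitting off z isolates L(0); the remainder involves only ω(i) = L(i-1) with i ≥ 2, which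
  -- strictly lowers weights.
  have hs : bracketSeries 2 1 = HahnSeries.single 1 1 +
      (bracketSeries 2 1 - HahnSeries.single 1 1) := by ring
  rw [hs, map_add, residue_single, one_smul, LinearMap.add_apply,
    Module.End.mem_eigenspace_iff.mp hu, add_sub_cancel_left, residue_apply]
  refine finsum_induction (· ∈ ⨆ (j : ℤ) (_ : j < n), (YU ω 1).eigenspace (r + j))
    (Submodule.zero_mem _) (fun _ _ ↦ Submodule.add_mem _) fun i ↦ ?_
  rcases lt_trichotomy i 1 with hi | rfl | hi
  · rw [HahnSeries.coeff_sub, bracketSeries_two_one_coeff_of_nonpos (by omega),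
      HahnSeries.coeff_single_of_ne hi.ne, sub_zero, zero_smul]
    exact Submodule.zero_mem _
  · rw [HahnSeries.coeff_sub, bracketSeries_two_one_coeff_one, HahnSeries.coeff_single_same,
      sub_self, zero_smul]
    exact Submodule.zero_mem _
  · refine Submodule.smul_mem _ _ (Submodule.mem_iSup_of_mem (n - (i - 1))
      (Submodule.mem_iSup_of_mem (by omega) ?_))
    have := virasoro_weight hL (i - 1) (k := r + n) (u := u) (by simpa using hu)
    simp only [zero_add, sub_add_cancel] at this
    convert this using 2
    push_cast
    ring

end Virasoro

/-! ### The operator L[0] on the vertex operator algebra -/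

namespace VertexOperatorAlgebra

variable {V : Type*} [AddCommGroup V] [Module ℂ V] (A : VertexOperatorAlgebra V)

/-- The projection `V → V_p` as a linear map. -/
def componentHom (p : ℤ) : V →ₗ[ℂ] V :=
  (A.weightSpace p).subtype ∘ₗ DirectSum.component ℂ ℤ (fun n ↦ A.weightSpace n) p ∘ₗ
    (LinearEquiv.ofBijective (DirectSum.coeLinearMap A.weightSpace) A.internal).symm.toLinearMap

lemma componentHom_apply (p : ℤ) (a : V) : A.componentHom p a = A.component p a := rfl

lemma component_support_finite (a : V) : {p | A.component p a ≠ 0}.Finite := by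
  classical
  set x := (LinearEquiv.ofBijective (DirectSum.coeLinearMap A.weightSpace) A.internal).symm a
    with hx
  refine x.support.finite_toSet.subset fun p hp ↦ ?_
  rw [Finset.mem_coe, DFinsupp.mem_support_toFun]
  intro h0
  refine hp ?_
  simp only [component]
  rw [← hx]
  exact congrArg Subtype.val h0

lemma component_of_mem {p : ℤ} {a : V} (ha : a ∈ A.weightSpace p) (q : ℤ) :
    A.component q a = if q = p then a else 0 := by
  classical
  have : (LinearEquiv.ofBijective (DirectSum.coeLinearMap A.weightSpace) A.internal).symm a =
      DirectSum.lof ℂ ℤ (fun n ↦ A.weightSpace n) p ⟨a, ha⟩ := by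
    rw [LinearEquiv.symm_apply_eq]
    exact (DirectSum.coeLinearMap_lof A.weightSpace p ⟨a, ha⟩).symm
  rw [component, this]
  split_ifs with hq
  · subst hq
    rw [DirectSum.lof_apply]
  · rw [DirectSum.lof_eq_of, DirectSum.of_eq_of_ne _ _ _ hq]
    rfl

lemma iSup_weightSpace : ⨆ p, A.weightSpace p = ⊤ := A.internal.submodule_iSup_eq_top

lemma ω_mem : A.ω ∈ A.weightSpace 2 := by
  rw [Module.End.mem_eigenspace_iff, A.ω_weight]
  norm_num

lemma vac_mem : A.vac ∈ A.weightSpace 0 := by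
  rw [Module.End.mem_eigenspace_iff, A.vac_weight]
  simp

lemma mode_ω_mem {p : ℤ} {a : V} (ha : a ∈ A.weightSpace p) (l : ℤ) :
    A.Y A.ω l a ∈ A.weightSpace (p + 1 - l) := by
  have := virasoro_weight A.virasoro (l - 1) (k := p) (u := a) (by simpa using ha)
  simp only [zero_add, sub_add_cancel] at this
  convert this using 2
  push_cast
  ring

/-- The operator `L[0]` on `V`. -/
def bracketL0 : Module.End ℂ V := residue A.Y A.truncated A.ω (bracketSeries 2 1)

lemma bracketL0_apply (a : V) {K : ℕ} (hK : ∀ l : ℕ, K ≤ l → A.Y A.ω l a = 0) :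
    A.bracketL0 a =
      ∑ l ∈ Finset.range K, (bracketSeries 2 1).coeff (l : ℤ) • A.Y A.ω l a := by
  rw [bracketL0, residue_apply]
  rw [finsum_eq_sum_of_support_subset (s := (Finset.range K).map Nat.castEmbedding)]
  · simp
  · intro i hi
    rcases lt_or_ge i 0 with hi0 | hi0
    · exact absurd (by simp [bracketSeries_two_one_coeff_of_nonpos hi0.le]) hi
    · lift i to ℕ using hi0
      simp only [Finset.coe_map, Set.mem_image]
      refine ⟨i, ?_, rfl⟩
      by_contra hiK
      exact hi (by simp [hK i (by simpa using hiK)])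

lemma iSup_eigenspace_bracketL0 : ⨆ k, A.bracketL0.eigenspace k = ⊤ := by
  obtain ⟨N, hN⟩ := A.bounded_below
  refine iSup_eigenspace_residue A.truncated A.virasoro N (fun n hn ↦ ?_) ?_
  · rw [← Int.cast_add]
    exact hN _ (by omega)
  · rw [eq_top_iff, ← A.iSup_weightSpace]
    refine iSup_le fun p ↦ le_iSup_of_le (p - N) (le_of_eq ?_)
    rw [← Int.cast_add, add_sub_cancel]

/-- Since ω = L(-2)𝟏 and L(l) kills the vacuum, only [L(l), L(-2)]𝟏 survives. Its central term
occurs at l = 2, with value (8-2)/12 · c = c/2. -/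
lemma mode_ω_ω (l : ℕ) : A.Y A.ω ((l + 1 : ℕ) : ℤ) A.ω =
    ((l : ℂ) + 2) • A.Y A.ω ((l : ℤ) - 1) A.vac +
      if l = 2 then (A.c / 2) • A.vac else 0 := by
  have h1 : A.Y A.ω (-1) A.vac = A.ω := A.creation A.ω
  have := LinearMap.congr_fun (A.virasoro l (-2)) A.vac
  simp only [LinearMap.sub_apply, Module.End.mul_apply, LinearMap.add_apply,
    LinearMap.smul_apply] at this
  rw [A.mode_vac A.ω (l + 1) (by positivity), map_zero, sub_zero,
    show (-2 + 1 : ℤ) = -1 by norm_num, h1] at this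
  push_cast
  rw [this]
  congr 1
  · rw [show (l : ℤ) + -2 + 1 = l - 1 by ring]
    push_cast
    congr 1
    ring
  · split_ifs with h1 h2 h2
    · subst h2
      simp only [LinearMap.smul_apply, Module.End.one_apply]
      congr 1
      norm_num
      ring
    · omega
    · omega
    · rfl

lemma bracketL0_vac : A.bracketL0 A.vac = 0 := by
  rw [A.bracketL0_apply A.vac (K := 0) fun l _ ↦ A.mode_vac A.ω l (by positivity)]
  simp

/-- The shift by c/24 is made for this: ω(3)ω = (c/2)𝟏 enters L[0]ω with the Taylor coefficient
-1/6, so L[0]ω = 2ω - (c/12)𝟏, while L[0]𝟏 = 0. -/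
lemma bracketL0_ωTilde : A.bracketL0 A.ωTilde = (2 : ℂ) • A.ωTilde := by
  have hω : A.bracketL0 A.ω = (2 : ℂ) • A.ω - (A.c / 12) • A.vac := by
    rw [A.bracketL0_apply A.ω (K := 4)]
    · have e2 := bracketSeries_two_one_coeff 0
      have e3 := bracketSeries_two_one_coeff 1
      have w2 := A.mode_ω_ω 1
      have w3 := A.mode_ω_ω 2
      have v0 := A.mode_vac A.ω 0 le_rfl
      have v1 := A.mode_vac A.ω 1 zero_le_one
      norm_num at e2 e3 w2 w3
      rw [v0, smul_zero] at w2
      rw [v1, smul_zero, zero_add] at w3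
      simp only [Finset.sum_range_succ, Finset.range_zero, Finset.sum_empty, Nat.cast_ofNat,
        Nat.cast_zero, Nat.cast_one]
      rw [bracketSeries_two_one_coeff_of_nonpos le_rfl, bracketSeries_two_one_coeff_one, e2, e3,
        w2, w3, A.ω_weight]
      module
    · intro l hl
      obtain ⟨m, rfl⟩ := Nat.exists_eq_add_of_le' (show 1 ≤ l by omega)
      rw [A.mode_ω_ω m, A.mode_vac A.ω _ (by omega), smul_zero, zero_add, if_neg (by omega)]
  rw [ωTilde, map_sub, map_smul, A.bracketL0_vac, hω]
  module

/-! ### The modes a[n] and the grading by L[0] on a module -/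

namespace VModule

variable {A} {U : Type*} [AddCommGroup U] [Module ℂ U] (M : A.VModule U)

/-- The modes `a[n]` as linear maps. -/
def bracketHom (n : ℤ) : V →ₗ[ℂ] Module.End ℂ U where
  toFun a := ∑ᶠ p : ℤ, residue M.YU M.truncated (A.component p a) (bracketSeries p n)
  map_add' a b := by
    rw [← finsum_add_distrib]
    · simp only [← componentHom_apply, map_add, LinearMap.add_apply]
    · exact (A.component_support_finite a).subset fun p hp h0 ↦ hp (by simp [h0])
    · exact (A.component_support_finite b).subset fun p hp h0 ↦ hp (by simp [h0])
  map_smul' c a := by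
    rw [RingHom.id_apply, smul_finsum]
    simp only [← componentHom_apply, map_smul, LinearMap.smul_apply]

lemma bracket_eq (a : V) (n : ℤ) (u : U) : M.bracket a n u = M.bracketHom n a u := by
  have := (LinearMap.toAddMonoidHom (LinearMap.applyₗ (R := ℂ) (M₂ := U) u)).map_finsum
    (f := fun p : ℤ ↦ residue M.YU M.truncated (A.component p a) (bracketSeries p n))
    ((A.component_support_finite a).subset fun p hp h0 ↦ hp (by simp [h0]))
  exact this.symm

lemma bracketHom_of_mem {p : ℤ} {a : V} (ha : a ∈ A.weightSpace p) (n : ℤ) :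
    M.bracketHom n a = residue M.YU M.truncated a (bracketSeries p n) := by
  change ∑ᶠ q : ℤ, residue M.YU M.truncated (A.component q a) (bracketSeries q n) = _
  rw [finsum_eq_single _ p fun q hq ↦ by rw [A.component_of_mem ha, if_neg hq]; simp,
    A.component_of_mem ha, if_pos rfl]

/-- The operator `L[0]` on `U`. -/
def bracketL0 : Module.End ℂ U := residue M.YU M.truncated A.ω (bracketSeries 2 1)

/-- The vacuum correction in ω̃ drops out: the vacuum only sees the coefficient of z⁻¹, and its
kernel log(1+z)/(1+z) has order 1. -/
lemma Lbracket_zero (u : U) : M.Lbracket 0 u = M.bracketL0 u := by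
  rw [Lbracket, bracket_eq, ωTilde, map_sub, map_smul, M.bracketHom_of_mem A.ω_mem,
    M.bracketHom_of_mem A.vac_mem, LinearMap.sub_apply, LinearMap.smul_apply]
  have : residue M.YU M.truncated A.vac (bracketSeries 0 (0 + 1)) u = 0 := by
    rw [residue_apply]
    refine (finsum_congr fun i ↦ ?_).trans finsum_zero
    rw [M.vac_mode]
    split_ifs with hi
    · rw [← bracketCoeff_eq, bracketCoeff_eq_zero _ _ _ (by omega), zero_smul]
    · simp
  rw [this, smul_zero, sub_zero]
  rfl

lemma mem_bracketWeightSpace {k : ℂ} {u : U} :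
    u ∈ M.bracketWeightSpace k ↔ u ∈ M.bracketL0.eigenspace k := by
  rw [Module.End.mem_eigenspace_iff, ← Lbracket_zero]
  rfl

/-- The commutator formula `[L[0], a[n]] = (L[0]a)[n] - (n+1) a[n]`. -/
theorem commutator_bracketL0 (a : V) (n : ℤ) (u : U) :
    M.bracketL0 (M.bracketHom n a u) - M.bracketHom n a (M.bracketL0 u) =
      M.bracketHom n (A.bracketL0 a) u - ((n : ℂ) + 1) • M.bracketHom n a u := by
  have ha : a ∈ ⨆ p, A.weightSpace p := by rw [A.iSup_weightSpace]; trivial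
  induction ha using Submodule.iSup_induction' with
  | zero => simp
  | add a b _ _ iha ihb =>
    simp only [map_add, LinearMap.add_apply, smul_add]
    rw [add_sub_add_comm, iha, ihb]
    abel
  | mem p a ha =>
    obtain ⟨N, hN⟩ := A.truncated A.ω a
    have hK : ∀ l : ℕ, N.toNat + 2 ≤ l → A.Y A.ω l a = 0 := fun l hl ↦ hN l (by omega)
    -- The main part (1+z)^(1-l) of the l-th Hasse derivative raises the exponent p - 1 to p - l,
    -- which is exactly the normalization for ω(l)a of weight p+1-l. These parts sum to (L[0]a)[n];
    -- extra terms occur for l = 0 and l = 1 only.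
    have hterm (l : ℕ) : residue M.YU M.truncated (A.Y A.ω l a)
        (LaurentSeries.hasseDeriv ℂ l (bracketSeries 2 1) * bracketSeries p n) u =
        (bracketSeries 2 1).coeff (l : ℤ) • M.bracketHom n (A.Y A.ω l a) u +
          (if l = 0 then residue M.YU M.truncated (A.Y A.ω 0 a)
            (bracketSeries (p + 1) (n + 1)) u else 0) +
          (if l = 1 then residue M.YU M.truncated (A.Y A.ω 1 a)
            (bracketSeries p (n + 1)) u else 0) := by
      rw [hasseDeriv_bracketSeries_two_one, add_mul, add_mul, mul_assoc, bracketSeries_mul,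
        HahnSeries.C_mul_eq_smul, map_add, map_add, LinearMap.add_apply, LinearMap.add_apply,
        M.bracketHom_of_mem (A.mode_ω_mem ha l)]
      congr 1
      · congr 1
        · rw [show (2 - (l : ℤ) + p - 1) = p + 1 - l by ring, zero_add]
          exact LinearMap.congr_fun (map_smul _ _ _) u
        · split_ifs with hl
          · subst hl
            rw [bracketSeries_mul, show 2 + p - 1 = p + 1 by ring, add_comm 1 n]
            rfl
          · simp
      · split_ifs with hl
        · subst hl
          rw [bracketSeries_mul, show 1 + p - 1 = p by ring, add_comm 1 n]
          rfl
        · simp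
    -- The l = 0 extra term involves L(-1)a, a z-derivative. Integration by parts gives -(n+1)a[n]
    -- and a term with factor -p, which cancels the l = 1 extra term because L(0)a = pa.
    have hparts : residue M.YU M.truncated (A.Y A.ω 0 a) (bracketSeries (p + 1) (n + 1)) =
        -(((n : ℂ) + 1) • residue M.YU M.truncated a (bracketSeries p n) +
          (p : ℂ) • residue M.YU M.truncated a (bracketSeries p (n + 1))) := by
      rw [residue_derivative M.truncated a _ (M.derivative a), LaurentSeries.derivative_apply,
        ← laurentDerivation_apply, laurentDerivation_bracketSeries]
      have e1 : (((n + 1 : ℤ) : LaurentSeries ℂ)) = HahnSeries.C ((n : ℂ) + 1) := by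
        rw [map_add, map_intCast, map_one]; push_cast; rfl
      have e2 : (((p + 1 : ℤ) : LaurentSeries ℂ)) - 1 = HahnSeries.C (p : ℂ) := by
        rw [map_intCast]; push_cast; ring
      rw [e1, e2, HahnSeries.C_mul_eq_smul, HahnSeries.C_mul_eq_smul, map_add,
        add_sub_cancel_right, add_sub_cancel_right]
      congr 2
      · exact map_smul _ _ _
      · exact map_smul _ _ _
    rw [M.bracketHom_of_mem ha, bracketL0, commutator_residue M.truncated M.jacobi A.ω a hK,
      A.bracketL0_apply a hK, Finset.sum_congr rfl fun l _ ↦ hterm l, Finset.sum_add_distrib,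
      Finset.sum_add_distrib, Finset.sum_ite_eq', Finset.sum_ite_eq', if_pos (by simp),
      if_pos (by simp), hparts, Module.End.mem_eigenspace_iff.mp ha, map_sum,
      LinearMap.sum_apply]
    simp only [map_smul, LinearMap.smul_apply, LinearMap.neg_apply, LinearMap.add_apply]
    abel

/-- `a[n]` maps `U_[k]` to `U_[k + p - n - 1]` for `a` in `V_[p]`. -/
lemma bracketHom_mem {p k : ℂ} {a : V} {u : U} (ha : a ∈ A.bracketL0.eigenspace p)
    (hu : u ∈ M.bracketL0.eigenspace k) (n : ℤ) :
    M.bracketHom n a u ∈ M.bracketL0.eigenspace (k + p - n - 1) := by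
  have := M.commutator_bracketL0 a n u
  rw [Module.End.mem_eigenspace_iff] at ha hu ⊢
  rw [ha, hu, map_smul, map_smul, sub_eq_iff_eq_add, LinearMap.smul_apply] at this
  rw [this]
  module

lemma Lbracket_eq (n : ℤ) (u : U) : M.Lbracket n u = M.bracketHom (n + 1) A.ωTilde u :=
  M.bracket_eq _ _ _

lemma Lbracket_mem {k : ℂ} {u : U} (hu : u ∈ M.bracketL0.eigenspace k) (n : ℤ) :
    M.Lbracket n u ∈ M.bracketL0.eigenspace (k - n) := by
  rw [Lbracket_eq]
  convert M.bracketHom_mem (p := 2) (Module.End.mem_eigenspace_iff.mpr A.bracketL0_ωTilde) hu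
    (n + 1) using 2
  push_cast
  ring

/-- The lowest weight r puts the spectrum of L(0) in r + ℕ, and each nonzero graded piece lies in
one of these eigenspaces, so the triangularity argument applies. -/
lemma iSup_eigenspace_bracketL0 {r : ℂ} (hr : M.IsLowestWeight r) :
    ⨆ k, M.bracketL0.eigenspace k = ⊤ := by
  refine iSup_eigenspace_residue M.truncated M.virasoro r (fun n hn ↦ ?_) ?_
  · by_contra hne
    obtain ⟨m, hm⟩ := hr.2 _ (Module.End.hasEigenvalue_iff.mpr hne)
    have : (n : ℂ) = ((m : ℤ) : ℂ) := by
      push_cast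
      exact add_left_cancel hm
    have := Int.cast_injective this
    omega
  · rw [eq_top_iff, ← M.gr_internal.submodule_iSup_eq_top]
    refine iSup_le fun n ↦ ?_
    obtain ⟨k, hk⟩ := M.gr_scalar n
    have hle : M.gr n ≤ (M.YU A.ω 1).eigenspace k := fun u hu ↦
      Module.End.mem_eigenspace_iff.mpr (hk u hu)
    rcases eq_or_ne (M.gr n) ⊥ with h0 | h0
    · rw [h0]; exact bot_le
    · obtain ⟨m, rfl⟩ := hr.2 k (Module.End.hasEigenvalue_iff.mpr
        (ne_bot_of_le_ne_bot h0 hle))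
      exact le_iSup_of_le (m : ℤ) (by simpa using hle)

end VModule

end VertexOperatorAlgebra

/-! ## Transformation under `τ ↦ -1/τ` -/

section Modular

open UpperHalfPlane

lemma coe_S_smul (τ : ℍ) : ((ModularGroup.S • τ : ℍ) : ℂ) = (-(τ : ℂ))⁻¹ := by
  rw [UpperHalfPlane.modular_S_smul]

lemma eisE_S_smul {k : ℕ} (hk : 3 ≤ k) (τ : ℍ) :
    eisE k (ModularGroup.S • τ) = (τ : ℂ) ^ k * eisE k τ := by
  have h (z : ℍ) : eisE k z = ((2 * riemannZeta k) / (2 * Real.pi * Complex.I) ^ k) *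
      ModularForm.E hk z := by
    rw [eisE, tsum_eisSummand_eq_riemannZeta_mul_eisensteinSeries hk,
      show ModularForm.E hk z = (1 / 2 : ℂ) • eisensteinSeries (N := 1) 0 k z from rfl]
    simp only [smul_eq_mul]
    ring
  have hE : ModularForm.E hk (ModularGroup.S • τ) = (τ : ℂ) ^ k * ModularForm.E hk τ := by
    have := SlashInvariantForm.slash_action_eqn'' (Γ := 𝒮ℒ) (ModularForm.E hk)
      (γ := (ModularGroup.S : SL(2, ℤ))) ⟨_, rfl⟩ τ
    rw [ModularGroup.denom_S, zpow_natCast] at this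
    exact this
  rw [h, h, hE]
  ring

/-- Here G_2(-1/τ) = τ² G_2(τ) - 2πiτ is divided by (2πi)². -/
lemma eisE2_S_smul (τ : ℍ) : eisE2 (ModularGroup.S • τ) =
    (τ : ℂ) ^ 2 * eisE2 τ - (2 * Real.pi * Complex.I)⁻¹ * τ := by
  have hτ : (τ : ℂ) ≠ 0 := ne_zero τ
  have := EisensteinSeries.G2_S_transform τ
  rw [eisE2, eisE2, this]
  have := Complex.two_pi_I_ne_zero
  field_simp
  ring

/-- The automorphy factor `(-iτ)^(-t) τ^(t-k)`. -/
def slashFactor (t : ℝ) (k : ℂ) (z : ℂ) : ℂ :=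
  (-Complex.I * z) ^ (-(t : ℂ)) * z ^ ((t : ℂ) - k)

/-- An integral shift of the exponent is harmless for the principal branch. -/
lemma slashFactor_sub (t : ℝ) (k : ℂ) (n : ℤ) {z : ℂ} (hz : z ≠ 0) :
    slashFactor t (k - n) z = slashFactor t k z * z ^ n := by
  rw [slashFactor, slashFactor, show (t : ℂ) - (k - n) = (t - k) + n by ring,
    Complex.cpow_add _ _ hz, Complex.cpow_intCast, mul_assoc]

/-- The exponents -t and t - k add up to -k in the logarithmic derivative. On the upper half-plane
-iz has positive real part and z positive imaginary part, so neither meets the branch cut. -/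
lemma hasDerivAt_slashFactor (t : ℝ) (k : ℂ) {z : ℂ} (hz : 0 < z.im) :
    HasDerivAt (slashFactor t k) (-k / z * slashFactor t k z) z := by
  have hz0 : z ≠ 0 := by rintro rfl; simp at hz
  have hz1 : -Complex.I * z ∈ Complex.slitPlane := by
    rw [Complex.mem_slitPlane_iff]
    left
    simpa using hz
  have hz2 : z ∈ Complex.slitPlane := by
    rw [Complex.mem_slitPlane_iff]
    exact Or.inr hz.ne'
  have hz3 : -Complex.I * z ≠ 0 := Complex.slitPlane_ne_zero hz1
  have h1 := ((hasDerivAt_id z).const_mul (-Complex.I)).cpow_const (c := -(t : ℂ)) hz1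
  have h2 := (hasDerivAt_id z).cpow_const (c := (t : ℂ) - k) hz2
  refine (h1.mul h2).congr_deriv ?_
  simp only [id_eq]
  rw [slashFactor, Complex.cpow_sub ((t : ℂ) - k) 1 hz0, Complex.cpow_sub (-(t : ℂ)) 1 hz3,
    Complex.cpow_one,
    Complex.cpow_one]
  field_simp
  ring

lemma hasDerivAt_slash (t : ℝ) (k : ℂ) {f g : ℍ → ℂ} (hg : MDifferentiable 𝓘(ℂ) 𝓘(ℂ) g)
    (hf : ∀ τ : ℍ, f τ = slashFactor t k τ * g (ModularGroup.S • τ)) (τ : ℍ) :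
    HasDerivAt (f ∘ ofComplex) (-k / τ * slashFactor t k τ * g (ModularGroup.S • τ) +
      slashFactor t k τ * (deriv (g ∘ ofComplex) ((ModularGroup.S • τ : ℍ) : ℂ) *
        ((τ : ℂ) ^ 2)⁻¹)) τ := by
  have hτ : (τ : ℂ) ≠ 0 := ne_zero τ
  have h1 : HasDerivAt (fun z : ℂ ↦ (-z)⁻¹) ((τ : ℂ) ^ 2)⁻¹ (τ : ℂ) := by
    have := (hasDerivAt_neg (τ : ℂ)).inv (neg_ne_zero.mpr hτ)
    rwa [neg_neg, neg_sq, one_div] at this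
  have h2 := (mdifferentiableAt_iff.mp (hg (ModularGroup.S • τ))).hasDerivAt
  have h3 : HasDerivAt (fun z : ℂ ↦ (g ∘ ofComplex) ((-z)⁻¹))
      (deriv (g ∘ ofComplex) ((ModularGroup.S • τ : ℍ) : ℂ) * ((τ : ℂ) ^ 2)⁻¹) (τ : ℂ) := by
    refine HasDerivAt.comp (h₂ := g ∘ ofComplex) (τ : ℂ) ?_ h1
    rwa [coe_S_smul] at h2 ⊢
  have h4 := (hasDerivAt_slashFactor t k τ.im_pos).mul h3
  have e0 : (g ∘ ofComplex) ((-(τ : ℂ))⁻¹) = g (ModularGroup.S • τ) := by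
    rw [← coe_S_smul, Function.comp_apply, ofComplex_apply]
  rw [e0] at h4
  refine h4.congr_of_eventuallyEq ?_
  filter_upwards [(isOpen_lt continuous_const Complex.continuous_im).mem_nhds τ.im_pos] with z hz
  have e1 : ((-z)⁻¹ : ℂ) = ((ModularGroup.S • (⟨z, hz⟩ : ℍ) : ℍ) : ℂ) := by rw [coe_S_smul]
  rw [Function.comp_apply, ofComplex_apply_of_im_pos hz, hf, Pi.mul_apply]
  simp only [e1, Function.comp_apply, ofComplex_apply]

lemma mdifferentiable_slash (t : ℝ) (k : ℂ) {f g : ℍ → ℂ} (hg : MDifferentiable 𝓘(ℂ) 𝓘(ℂ) g)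
    (hf : ∀ τ : ℍ, f τ = slashFactor t k τ * g (ModularGroup.S • τ)) :
    MDifferentiable 𝓘(ℂ) 𝓘(ℂ) f :=
  fun τ ↦ mdifferentiableAt_iff.mpr (hasDerivAt_slash t k hg hf τ).differentiableAt

/-- The operator `∂_k` intertwines the slash operators of weights `k` and `k + 2`. -/
lemma modularDeriv_slash (t : ℝ) (k : ℂ) {f g : ℍ → ℂ} (hg : MDifferentiable 𝓘(ℂ) 𝓘(ℂ) g)
    (hf : ∀ τ : ℍ, f τ = slashFactor t k τ * g (ModularGroup.S • τ)) (τ : ℍ) :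
    modularDeriv k f τ = slashFactor t k τ * ((τ : ℂ) ^ 2)⁻¹ *
      modularDeriv k g (ModularGroup.S • τ) := by
  have hτ : (τ : ℂ) ≠ 0 := ne_zero τ
  -- The -k/τ from differentiating the factor, divided by 2πi, matches k times the anomaly of E_2.
  rw [modularDeriv, modularDeriv, (hasDerivAt_slash t k hg hf τ).deriv, eisE2_S_smul, hf]
  field_simp
  ring

lemma modularRing_mdifferentiable (f : modularRing) :
    MDifferentiable 𝓘(ℂ) 𝓘(ℂ) (f : ℍ → ℂ) := by
  obtain ⟨f, hf⟩ := f
  change MDifferentiable 𝓘(ℂ) 𝓘(ℂ) f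
  induction hf using Algebra.adjoin_induction with
  | mem x hx =>
    obtain ⟨k, g, rfl⟩ := hx
    exact g.holo'
  | algebraMap r => exact mdifferentiable_const
  | add x y _ _ hx hy => exact hx.add hy
  | mul x y _ _ hx hy => exact hx.mul hy

end Modular

/-! ### The slashed function: membership in C_1(U), existence and uniqueness -/

namespace VertexOperatorAlgebra.VModule

variable {V U : Type*} [AddCommGroup V] [Module ℂ V] [AddCommGroup U] [Module ℂ U]
  {A : VertexOperatorAlgebra V} (M : A.VModule U)

/-- The second kind of generators of `O_q(U)`. -/
def quasiGenerator (v : V) (u : U) : modularRing ⊗[ℂ] U :=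
  1 ⊗ₜ[ℂ] M.bracket v (-2) u +
    ∑ᶠ i : ℕ, (2 * (i + 2) - 1 : ℂ) • (eis i ⊗ₜ[ℂ] M.bracket v (2 * (i + 2) - 2) u)

lemma quasiGenerator_support_finite (v : V) (u : U) :
    (Function.support fun i : ℕ ↦ (2 * (i + 2) - 1 : ℂ) •
      (eis i ⊗ₜ[ℂ] M.bracket v (2 * (i + 2) - 2) u)).Finite := by
  obtain ⟨N, hN⟩ := M.exists_bracket_eq_zero v u
  refine (Set.finite_Iio N.toNat).subset fun i hi ↦ ?_
  by_contra hle
  refine hi ?_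
  have : M.bracket v (2 * (i + 2) - 2) u = 0 := hN _ (by simp at hle; omega)
  simp [this]

/-- Biadditivity allows the vanishing on generators to be tested on L[0]-eigenvectors v and u. -/
lemma quasiGenerator_add_left (v w : V) (u : U) :
    M.quasiGenerator (v + w) u = M.quasiGenerator v u + M.quasiGenerator w u := by
  simp only [quasiGenerator]
  rw [add_add_add_comm, ← finsum_add_distrib (M.quasiGenerator_support_finite v u)
    (M.quasiGenerator_support_finite w u)]
  simp only [bracket_eq, map_add, LinearMap.add_apply, TensorProduct.tmul_add, smul_add]

lemma quasiGenerator_add_right (v : V) (u w : U) :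
    M.quasiGenerator v (u + w) = M.quasiGenerator v u + M.quasiGenerator v w := by
  simp only [quasiGenerator]
  rw [add_add_add_comm, ← finsum_add_distrib (M.quasiGenerator_support_finite v u)
    (M.quasiGenerator_support_finite v w)]
  simp only [bracket_eq, map_add, TensorProduct.tmul_add, smul_add]

lemma quasiGenerator_zero_left (u : U) : M.quasiGenerator 0 u = 0 := by
  simp [quasiGenerator, bracket_eq]

lemma quasiGenerator_zero_right (v : V) : M.quasiGenerator v 0 = 0 := by
  simp [quasiGenerator, bracket_eq]

lemma apply_tmul (T : (modularRing ⊗[ℂ] U) →ₗ[modularRing] (ℍ → ℂ)) (f : modularRing) (u : U) :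
    T (f ⊗ₜ[ℂ] u) = (f : ℍ → ℂ) * T (1 ⊗ₜ[ℂ] u) := by
  rw [show f ⊗ₜ[ℂ] u = f • ((1 : modularRing) ⊗ₜ[ℂ] u) by
    rw [TensorProduct.smul_tmul', smul_eq_mul, mul_one], map_smul]
  rfl

lemma apply_quasiGenerator (T : (modularRing ⊗[ℂ] U) →ₗ[modularRing] (ℍ → ℂ)) (v : V) (u : U)
    (τ : ℍ) : T (M.quasiGenerator v u) τ = T (1 ⊗ₜ[ℂ] M.bracket v (-2) u) τ +
      ∑ᶠ i : ℕ, (2 * (i + 2) - 1 : ℂ) * (eisE (2 * (i + 2)) τ *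
        T (1 ⊗ₜ[ℂ] M.bracket v (2 * (i + 2) - 2) u) τ) := by
  rw [quasiGenerator, map_add, Pi.add_apply]
  congr 1
  have := ((Pi.evalAddMonoidHom (fun _ : ℍ ↦ ℂ) τ).comp T.toAddMonoidHom).map_finsum
    (M.quasiGenerator_support_finite v u)
  refine this.trans (finsum_congr fun i ↦ ?_)
  change T ((2 * (i + 2) - 1 : ℂ) • (eis i ⊗ₜ[ℂ] M.bracket v (2 * (i + 2) - 2) u)) τ = _
  rw [LinearMap.map_smul_of_tower, apply_tmul]
  rfl

variable {M} {t : ℝ} {S T : (modularRing ⊗[ℂ] U) →ₗ[modularRing] (ℍ → ℂ)}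

lemma IsSlash.apply (hT : M.IsSlash t S T) {k : ℂ} {u : U} (hu : u ∈ M.bracketL0.eigenspace k)
    (τ : ℍ) : T (1 ⊗ₜ[ℂ] u) τ = slashFactor t k τ * S (1 ⊗ₜ[ℂ] u) (ModularGroup.S • τ) :=
  hT k u (M.mem_bracketWeightSpace.mpr hu) τ

/-- Multiplication by an Eisenstein series intertwines the slash operators. -/
lemma IsSlash.eis_mul_apply (hT : M.IsSlash t S T) {k : ℂ} {u : U} (i : ℕ)
    (hu : u ∈ M.bracketL0.eigenspace (k - (2 * (i + 2) : ℤ))) (τ : ℍ) :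
    eisE (2 * (i + 2)) τ * T (1 ⊗ₜ[ℂ] u) τ = slashFactor t k τ *
      (eisE (2 * (i + 2)) (ModularGroup.S • τ) * S (1 ⊗ₜ[ℂ] u) (ModularGroup.S • τ)) := by
  rw [hT.apply hu, slashFactor_sub t k _ (UpperHalfPlane.ne_zero τ), eisE_S_smul (by omega),
    show (2 * (i + 2) : ℤ) = ((2 * (i + 2) : ℕ) : ℤ) by push_cast; rfl, zpow_natCast]
  ring

lemma mdifferentiable_of_isSlash (htop : ⨆ k, M.bracketL0.eigenspace k = ⊤)
    (hS : S ∈ M.C1) (hT : M.IsSlash t S T)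
    (x : modularRing ⊗[ℂ] U) : MDifferentiable 𝓘(ℂ) 𝓘(ℂ) (T x) := by
  induction x with
  | zero => rw [map_zero]; exact mdifferentiable_const
  | add x y hx hy => rw [map_add]; exact hx.add hy
  | tmul f u =>
    rw [apply_tmul]
    refine (modularRing_mdifferentiable f).mul ?_
    have hu : u ∈ ⨆ k, M.bracketL0.eigenspace k := by rw [htop]; trivial
    induction hu using Submodule.iSup_induction' with
    | zero => rw [TensorProduct.tmul_zero, map_zero]; exact mdifferentiable_const
    | add u w _ _ hu hw => rw [TensorProduct.tmul_add, map_add]; exact hu.add hw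
    | mem k u hu => exact mdifferentiable_slash t k (hS.1 _) (hT.apply hu)

/-- For v, u of L[0]-weights p, k, the vector v[-2]u has weight k+p+1 and v[2j-2]u has weight
k+p+1-2j, the deficit being supplied by E_{2j}. So T at τ is one common factor times S of the same
generator at -1/τ, which is zero. -/
lemma IsSlash.apply_quasiGenerator (htop : ⨆ k, M.bracketL0.eigenspace k = ⊤)
    (hS : S ∈ M.C1) (hT : M.IsSlash t S T) (v : V) (u : U) :
    T (M.quasiGenerator v u) = 0 := by
  have hu : u ∈ ⨆ k, M.bracketL0.eigenspace k := by rw [htop]; trivial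
  induction hu using Submodule.iSup_induction' with
  | zero => rw [quasiGenerator_zero_right, map_zero]
  | add u w _ _ hu hw => rw [quasiGenerator_add_right, map_add, hu, hw, add_zero]
  | mem k u hu =>
    have hv : v ∈ ⨆ p, A.bracketL0.eigenspace p := by rw [A.iSup_eigenspace_bracketL0]; trivial
    induction hv using Submodule.iSup_induction' with
    | zero => rw [quasiGenerator_zero_left, map_zero]
    | add v w _ _ hv hw => rw [quasiGenerator_add_left, map_add, hv, hw, add_zero]
    | mem p v hv =>
      ext τ
      have hmem (n : ℤ) : M.bracket v n u ∈ M.bracketL0.eigenspace (k + p - n - 1) := by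
        rw [bracket_eq]; exact M.bracketHom_mem hv hu n
      have hSx : S (M.quasiGenerator v u) = 0 :=
        hS.2.1 _ (Submodule.subset_span (Or.inr ⟨v, u, rfl⟩))
      have h1 : T (1 ⊗ₜ[ℂ] M.bracket v (-2) u) τ = slashFactor t (k + p + 1) τ *
          S (1 ⊗ₜ[ℂ] M.bracket v (-2) u) (ModularGroup.S • τ) := by
        refine hT.apply ?_ τ
        convert hmem (-2) using 2
        push_cast
        ring
      have h2 (i : ℕ) := hT.eis_mul_apply (k := k + p + 1)
        (u := M.bracket v (2 * (i + 2) - 2) u) i (by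
          convert hmem (2 * (i + 2) - 2) using 2
          push_cast
          ring) τ
      rw [VModule.apply_quasiGenerator, h1]
      simp only [h2, mul_left_comm _ (slashFactor t (k + p + 1) τ)]
      rw [← mul_finsum, ← mul_add, ← VModule.apply_quasiGenerator, hSx, Pi.zero_apply, mul_zero,
        Pi.zero_apply]

lemma IsSlash.apply_bracket_zero (htop : ⨆ k, M.bracketL0.eigenspace k = ⊤)
    (hS : S ∈ M.C1) (hT : M.IsSlash t S T) (v : V) (u : U) :
    T (1 ⊗ₜ[ℂ] M.bracket v 0 u) = 0 := by
  simp only [bracket_eq]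
  have hu : u ∈ ⨆ k, M.bracketL0.eigenspace k := by rw [htop]; trivial
  induction hu using Submodule.iSup_induction' with
  | zero => rw [map_zero, TensorProduct.tmul_zero, map_zero]
  | add u w _ _ hu hw => rw [map_add, TensorProduct.tmul_add, map_add, hu, hw, add_zero]
  | mem k u hu =>
    have hv : v ∈ ⨆ p, A.bracketL0.eigenspace p := by rw [A.iSup_eigenspace_bracketL0]; trivial
    induction hv using Submodule.iSup_induction' with
    | zero => rw [map_zero, LinearMap.zero_apply, TensorProduct.tmul_zero, map_zero]
    | add v w _ _ hv hw =>
      rw [map_add, LinearMap.add_apply, TensorProduct.tmul_add, map_add, hv, hw, add_zero]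
    | mem p v hv =>
      ext τ
      have hSx : S (1 ⊗ₜ[ℂ] M.bracketHom 0 v u) = 0 :=
        hS.2.1 _ (Submodule.subset_span (Or.inl ⟨v, u, by rw [bracket_eq]⟩))
      rw [hT.apply (M.bracketHom_mem hv hu 0), hSx, Pi.zero_apply, mul_zero, Pi.zero_apply]

theorem IsSlash.mem_C1 (htop : ⨆ k, M.bracketL0.eigenspace k = ⊤)
    (hS : S ∈ M.C1) (hT : M.IsSlash t S T) : T ∈ M.C1 := by
  refine ⟨mdifferentiable_of_isSlash htop hS hT, fun x hx ↦ ?_, fun k u hu τ ↦ ?_⟩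
  · induction hx using Submodule.span_induction with
    | mem x hx =>
      rcases hx with ⟨v, u, rfl⟩ | ⟨v, u, rfl⟩
      · exact hT.apply_bracket_zero htop hS v u
      · exact hT.apply_quasiGenerator htop hS v u
    | zero => exact map_zero T
    | add x y _ _ hx hy => rw [map_add, hx, hy, add_zero]
    | smul f x _ hx => rw [map_smul, hx, smul_zero]
  · have hu' := M.mem_bracketWeightSpace.mp hu
    have h1 : T (1 ⊗ₜ[ℂ] M.Lbracket (-2) u) τ = slashFactor t k τ * ((τ : ℂ) ^ 2)⁻¹ *
        S (1 ⊗ₜ[ℂ] M.Lbracket (-2) u) (ModularGroup.S • τ) := by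
      rw [hT.apply (M.Lbracket_mem hu' (-2)), slashFactor_sub t k _ (UpperHalfPlane.ne_zero τ)]
      rfl
    -- This is the common factor of weight k + 2, shared by L[-2]u, the derivative term and all
    -- E_{2j} L[2j-2]u.
    have hf : slashFactor t k τ * ((τ : ℂ) ^ 2)⁻¹ = slashFactor t (k + 2) τ := by
      have := slashFactor_sub t k (-2) (UpperHalfPlane.ne_zero τ)
      rw [show k - ((-2 : ℤ) : ℂ) = k + 2 by push_cast; ring] at this
      exact this.symm
    have h2 (i : ℕ) := hT.eis_mul_apply (k := k + 2)
      (u := M.Lbracket (2 * (i + 2) - 2) u) i (by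
        convert M.Lbracket_mem hu' (2 * (i + 2) - 2) using 2
        push_cast
        ring) τ
    rw [h1, hS.2.2 k u hu, modularDeriv_slash t k (hS.1 _) (hT.apply hu')]
    simp only [h2]
    rw [← mul_finsum, hf, mul_add]

/-- Eigenspaces of L[0] are independent and span U, so the prescribed formulas on them glue to a
linear map on U, which extends by base change to `modularRing`. -/
lemma exists_isSlash (htop : ⨆ k, M.bracketL0.eigenspace k = ⊤)
    (t : ℝ) (S : (modularRing ⊗[ℂ] U) →ₗ[modularRing] (ℍ → ℂ)) :
    ∃ T, M.IsSlash t S T := by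
  classical
  have hint : DirectSum.IsInternal fun k ↦ M.bracketL0.eigenspace k :=
    DirectSum.isInternal_submodule_of_iSupIndep_of_iSup_eq_top
      M.bracketL0.eigenspaces_iSupIndep htop
  let e := LinearEquiv.ofBijective (DirectSum.coeLinearMap fun k ↦ M.bracketL0.eigenspace k) hint
  let φ (k : ℂ) : U →ₗ[ℂ] (ℍ → ℂ) :=
    { toFun := fun u τ ↦ slashFactor t k τ * S (1 ⊗ₜ[ℂ] u) (ModularGroup.S • τ)
      map_add' := fun u w ↦ by
        ext τ
        simp only [TensorProduct.tmul_add, map_add, Pi.add_apply, mul_add]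
      map_smul' := fun c u ↦ by
        ext τ
        simp only [TensorProduct.tmul_smul, LinearMap.map_smul_of_tower, Pi.smul_apply,
          smul_eq_mul, RingHom.id_apply, mul_left_comm] }
  let T₀ : U →ₗ[ℂ] (ℍ → ℂ) :=
    DirectSum.toModule ℂ ℂ (ℍ → ℂ) (fun k ↦ φ k ∘ₗ (M.bracketL0.eigenspace k).subtype) ∘ₗ
      e.symm.toLinearMap
  refine ⟨T₀.liftBaseChange modularRing, fun k u hu τ ↦ ?_⟩
  have hu' := M.mem_bracketWeightSpace.mp hu
  have he : e.symm u = DirectSum.lof ℂ ℂ (fun k ↦ M.bracketL0.eigenspace k) k ⟨u, hu'⟩ := by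
    rw [LinearEquiv.symm_apply_eq]
    exact (DirectSum.coeLinearMap_lof _ k ⟨u, hu'⟩).symm
  rw [LinearMap.liftBaseChange_one_tmul]
  have : T₀ u = φ k u := by
    change DirectSum.toModule ℂ ℂ (ℍ → ℂ) _ (e.symm u) = _
    rw [he, DirectSum.toModule_lof]
    rfl
  rw [this]
  rfl

lemma IsSlash.unique (htop : ⨆ k, M.bracketL0.eigenspace k = ⊤)
    {T' : (modularRing ⊗[ℂ] U) →ₗ[modularRing] (ℍ → ℂ)}
    (hT : M.IsSlash t S T) (hT' : M.IsSlash t S T') : T' = T := by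
  refine LinearMap.ext fun x ↦ ?_
  induction x with
  | zero => rw [map_zero, map_zero]
  | add x y hx hy => rw [map_add, map_add, hx, hy]
  | tmul f u =>
    rw [apply_tmul T' f u, apply_tmul T f u]
    congr 1
    have hu : u ∈ ⨆ k, M.bracketL0.eigenspace k := by rw [htop]; trivial
    induction hu using Submodule.iSup_induction' with
    | zero => rw [TensorProduct.tmul_zero, map_zero, map_zero]
    | add u w _ _ hu hw => rw [TensorProduct.tmul_add, map_add, map_add, hu, hw]
    | mem k u hu =>
      ext τ
      rw [hT.apply hu, hT'.apply hu]

end VertexOperatorAlgebra.VModule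

end TraceVOA

end

open TraceVOA
theorem theorem5p1 {V U : Type*} [AddCommGroup V] [Module ℂ V] [AddCommGroup U] [Module ℂ U]
    (A : VertexOperatorAlgebra V) (M : A.VModule U) (hM : M.IsIrreducible)
    (t : ℝ) (m : ℤ) (ht : -1 < t) (ht' : t ≤ 1) (hlow : M.IsLowestWeight ((t : ℂ) + 2 * m))
    (S : (modularRing ⊗[ℂ] U) →ₗ[modularRing] (ℍ → ℂ)) (hS : S ∈ M.C1) :
    (∃! T, M.IsSlash t S T) ∧ ∀ T, M.IsSlash t S T → T ∈ M.C1 := by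
  have htop := M.iSup_eigenspace_bracketL0 hlow
  obtain ⟨T, hT⟩ := VertexOperatorAlgebra.VModule.exists_isSlash htop t S
  exact ⟨⟨T, hT, fun T' hT' ↦ hT.unique htop hT'⟩, fun T' hT' ↦ hT'.mem_C1 htop hS⟩
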